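/- Let $\Theta\subset\mathbb{R}^2$ be open, convex and bounded with $\overline{\Theta}\subset(0,\infty)^2$, write $\theta=(\delta,\gamma)$, and let $(P_\theta)_{\theta\in\Theta}$ be probability measures under which the process $X=(X_t)_{t\ge 0}$ is the inverse-Gaussian subordinator, i.e. the Lévy process with $\mathcal{L}(X_t)=IG(\delta t,\gamma)$ for $t>0$, where $IG(\delta,\gamma)$ has the density $$x\mapsto\frac{\delta e^{\delta\gamma}}{\sqrt{2\pi}}x^{-3/2}\exp\Big\{-\frac12\Big(\gamma^2x+\frac{\delta^2}{x}\Big)\Big\},\qquad x>0.$$ For each $n\ge1$, $X$ is observed at the times $jh_n$, $0\le j\le n$, where $h_n>0$; put $T_n=nh_n$ and $\Delta_jX=X_{jh_n}-X_{(j-1)h_n}$. Up to a term free of $\theta$, the log-likelihood function is $$\ell_n(\theta)=\sum_{j=1}^n\Big\{\log\delta+\delta\gamma h_n-\frac12\Big(\frac{\delta^2h_n^2}{\Delta_jX}+\gamma^2\Delta_jX\Big)\Big\}.$$ Let $\hat\theta_n=(\hat\delta_n,\hat\gamma_n)$ with $$\hat\delta_n=\Big\{\frac1n\Big(\sum_{j=1}^n\frac{h_n^2}{\Delta_jX}-\frac{T_n^2}{X_{T_n}}\Big)\Big\}^{-1/2},\qquad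 \hat\gamma_n=\frac{T_n\hat\delta_n}{X_{T_n}}.$$ Suppose that $T_n\to\infty$ and $h_n\to0$ as $n\to\infty$, and put $$A_n=\mathrm{diag}\Big(\frac1{\sqrt n},\frac1{\sqrt{T_n}}\Big),\qquad I(\theta)=\mathrm{diag}\Big(\frac{2}{\delta^2},\frac{\delta}{\gamma}\Big).$$ Write $\to_u$ for uniform convergence over each compact subset of $\Theta$. For random functions $\zeta_n(\theta)$, measurable with respect to $\sigma(X_{jh_n};0\le j\le n)$, convergence in law $\zeta_n(\theta)\Rightarrow_u\nu_\theta$ and in probability $\zeta_n(\theta)\to_{p,u}c(\theta)$ mean that, respectively, $$\sup_{\|f\|_{BL}\le1}\Big|E_\theta f(\zeta_n(\theta))-\int f\,d\nu_\theta\Big|\to_u0,\qquad E_\theta\frac{|\zeta_n(\theta)-c(\theta)|}{1+|\zeta_n(\theta)-c(\theta)|}\to_u0,$$ where $\|f\|_{BL}=\sup_{x\ne y}|f(x)-f(y)|/|x-y|+\sup_x|f(x)|$. Then: 1. $\hat\theta_n$ is the MLE: for every $n\ge2$ and $\theta\in\Theta$, $P_\theta$-almost surely $\hat\theta_n\in(0,\infty)^2$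 and $\hat\theta_n$ maximizes $\ell_n$ over $(0,\infty)^2$. 2. The model is uniformly locally asymptotically normal (ULAN) in $\Theta$ with rate $A_n$ and Fisher information $I(\theta)$: with the score $S_n(\theta)=\partial_\theta\ell_n(\theta)$ and the observed information $I_n(\theta)=-\partial_\theta^2\ell_n(\theta)$, the $\ell_n$ are of class $C^2$ on $\Theta$, the entries of $A_n$ are positive and tend to $0$, $I(\theta)$ is positive definite, $$A_nS_n(\theta)\Rightarrow_uN_2(0,I(\theta)),\qquad A_nI_n(\theta)A_n\to_{p,u}I(\theta),$$ and for every non-random bounded sequence $(u_n)\subset\mathbb{R}^2$, $$\ell_n(\theta+A_nu_n)-\ell_n(\theta)-\Big(S_n(\theta)^\top A_nu_n-\frac12(A_nu_n)^\top I_n(\theta)A_nu_n\Big)\to_{p,u}0.$$ 3. $A_n^{-1}(\hat\theta_n-\theta)\Rightarrow_uN_2(0,I(\theta)^{-1})$. -/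

import Mathlib

open MeasureTheory ProbabilityTheory Filter Topology
open scoped NNReal ENNReal

noncomputable section

/-! ### Uniform convergence in law and in probability -/

section General

variable {Ω : Type*}

/-- The unit ball of the bounded-Lipschitz norm
`‖f‖_BL = sup_{x ≠ y} |f x - f y| / |x - y| + sup_x |f x|`. -/
def blUnitBall (E : Type*) [PseudoEMetricSpace E] : Set (E → ℝ) :=
  {f | ∃ L M : ℝ≥0, LipschitzWith L f ∧ (∀ x, |f x| ≤ M) ∧ L + M ≤ 1}

/-- Bounded-Lipschitz distance between the law of `ζ` under `P` and the probability measure `ν`. -/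
def blDist [MeasurableSpace Ω] {E : Type*} [PseudoEMetricSpace E] [MeasurableSpace E]
    (P : Measure Ω) (ζ : Ω → E) (ν : Measure E) : ℝ :=
  sSup {r | ∃ f ∈ blUnitBall E, r = |(∫ ω, f (ζ ω) ∂P) - ∫ x, f x ∂ν|}

/-- The metric `E[|ζ - c| / (1 + |ζ - c|)]` of convergence in probability under `P`. -/
def probDist [MeasurableSpace Ω] (P : Measure Ω) (ζ : Ω → ℝ) (c : ℝ) : ℝ :=
  ∫ ω, |ζ ω - c| / (1 + |ζ ω - c|) ∂P

/-- `g n → g∞` uniformly over each compact subset of `Θ`. -/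
def UnifTendsto {T : Type*} [TopologicalSpace T] (Θ : Set T) (g : ℕ → T → ℝ) (g' : T → ℝ) : Prop :=
  ∀ K ⊆ Θ, IsCompact K → TendstoUniformlyOn g g' atTop K

/-- Observability: on each compact subset of `Θ`, `ζ n θ` is, for `n` large, a function of the
data available at stage `n`, that is, measurable for the σ-algebra `𝓖 n`. -/
def EventuallyObservable {T E : Type*} [TopologicalSpace T] [MeasurableSpace E]
    (𝓖 : ℕ → MeasurableSpace Ω) (Θ : Set T) (ζ : ℕ → T → Ω → E) : Prop :=
  ∀ K ⊆ Θ, IsCompact K → ∀ᶠ n in atTop, ∀ θ ∈ K, Measurable[𝓖 n] (ζ n θ)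

/-- Convergence in law of `ζ n θ` under `P θ` to `ν θ`, uniformly over compact subsets of `Θ`. -/
def UnifTendstoInLaw [MeasurableSpace Ω] {T E : Type*} [TopologicalSpace T] [PseudoEMetricSpace E] [MeasurableSpace E]
    (𝓖 : ℕ → MeasurableSpace Ω) (P : T → Measure Ω) (Θ : Set T)
    (ζ : ℕ → T → Ω → E) (ν : T → Measure E) : Prop :=
  EventuallyObservable 𝓖 Θ ζ ∧
    UnifTendsto Θ (fun n θ => blDist (P θ) (ζ n θ) (ν θ)) (fun _ => 0)

/-- Convergence in probability of `ζ n θ` under `P θ` to the number `c θ`, uniformly over compact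
subsets of `Θ`. -/
def UnifTendstoInProb [MeasurableSpace Ω] {T : Type*} [TopologicalSpace T]
    (𝓖 : ℕ → MeasurableSpace Ω) (P : T → Measure Ω) (Θ : Set T)
    (ζ : ℕ → T → Ω → ℝ) (c : T → ℝ) : Prop :=
  EventuallyObservable 𝓖 Θ ζ ∧
    UnifTendsto Θ (fun n θ => probDist (P θ) (ζ n θ) (c θ)) (fun _ => 0)

/-! ### Uniform local asymptotic normality -/

/-- Partial derivative in the `k`-th coordinate. -/
def partialDeriv {p : ℕ} (k : Fin p) (f : EuclideanSpace ℝ (Fin p) → ℝ)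
    (θ : EuclideanSpace ℝ (Fin p)) : ℝ :=
  fderiv ℝ f θ (EuclideanSpace.single k 1)

/-- The score function `∂_θ ℓ`. -/
def scoreFun {p : ℕ} (l : EuclideanSpace ℝ (Fin p) → ℝ) (θ : EuclideanSpace ℝ (Fin p)) :
    EuclideanSpace ℝ (Fin p) :=
  WithLp.toLp 2 fun k => partialDeriv k l θ

/-- The observed information matrix `-∂_θ² ℓ`. -/
def observedInfo {p : ℕ} (l : EuclideanSpace ℝ (Fin p) → ℝ) (θ : EuclideanSpace ℝ (Fin p)) :
    Matrix (Fin p) (Fin p) ℝ :=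
  Matrix.of fun i j => -partialDeriv i (partialDeriv j l) θ

/-- The family `P θ`, `θ ∈ Θ`, observed through the σ-algebras `𝓖 n` and with log-likelihood
functions `ℓ n`, is uniformly locally asymptotically normal (ULAN) in `Θ` with rate
`A n θ = diag (a n θ)` and Fisher information `I θ`. Convergence of matrices is entrywise. -/
structure IsULAN [MeasurableSpace Ω] {p : ℕ} (𝓖 : ℕ → MeasurableSpace Ω)
    (P : EuclideanSpace ℝ (Fin p) → Measure Ω) (Θ : Set (EuclideanSpace ℝ (Fin p)))
    (ℓ : ℕ → EuclideanSpace ℝ (Fin p) → Ω → ℝ)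
    (a : ℕ → EuclideanSpace ℝ (Fin p) → Fin p → ℝ)
    (I : EuclideanSpace ℝ (Fin p) → Matrix (Fin p) (Fin p) ℝ) : Prop where
  observable : ∀ n, ∀ θ ∈ Θ, Measurable[𝓖 n] (ℓ n θ)
  contDiffOn : ∀ n, ∀ θ ∈ Θ, ∀ᵐ ω ∂(P θ), ContDiffOn ℝ 2 (fun ρ => ℓ n ρ ω) Θ
  rate_pos : ∀ n, 1 ≤ n → ∀ θ ∈ Θ, ∀ k, 0 < a n θ k
  rate_tendsto : ∀ k, UnifTendsto Θ (fun n θ => a n θ k) (fun _ => 0)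
  posDef : ∀ θ ∈ Θ, (I θ).PosDef
  /-- `A_n S_n ⇒ N(0, I)` -/
  score : UnifTendstoInLaw 𝓖 P Θ
    (fun n θ ω => Matrix.toEuclideanLin (Matrix.diagonal (a n θ)) (scoreFun (fun ρ => ℓ n ρ ω) θ))
    (fun θ => multivariateGaussian 0 (I θ))
  /-- `A_n I_n A_n → I` in probability -/
  info : ∀ i j, UnifTendstoInProb 𝓖 P Θ
    (fun n θ ω => (Matrix.diagonal (a n θ) * observedInfo (fun ρ => ℓ n ρ ω) θ
      * Matrix.diagonal (a n θ)) i j)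
    (fun θ => I θ i j)
  /-- the quadratic expansion of the log-likelihood ratio along every bounded sequence `u` -/
  expansion : ∀ u : ℕ → EuclideanSpace ℝ (Fin p), Bornology.IsBounded (Set.range u) →
    UnifTendstoInProb 𝓖 P Θ
      (fun n θ ω =>
        let v : EuclideanSpace ℝ (Fin p) := Matrix.toEuclideanLin (Matrix.diagonal (a n θ)) (u n)
        let l : EuclideanSpace ℝ (Fin p) → ℝ := fun ρ => ℓ n ρ ω
        l (θ + v) - l θ -
          (∑ i, scoreFun l θ i * v i - 1 / 2 * ∑ i, ∑ j, observedInfo l θ i j * v i * v j))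
      (fun _ => 0)

/-- A real-valued Lévy process under `P` (as usual, up to modification: no path regularity beyond
stochastic continuity is asked for). -/
structure IsLevyProcess [MeasurableSpace Ω] (X : ℝ≥0 → Ω → ℝ) (P : Measure Ω) : Prop where
  measurable : ∀ t, Measurable (X t)
  zero : ∀ᵐ ω ∂P, X 0 ω = 0
  indep : HasIndepIncrements X P
  stationary : ∀ s t, IdentDistrib (fun ω => X (s + t) ω - X s ω) (X t) P P
  stochCont : ∀ t, TendstoInMeasure P X (𝓝 t) (X t)

/-- The σ-algebra `σ(X_{t_j} ; 0 ≤ j ≤ n)` of the data at stage `n`, where `t_j = j h_n`. -/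
@[reducible]
def obsSigma (X : ℝ≥0 → Ω → ℝ) (h : ℕ → ℝ≥0) (n : ℕ) : MeasurableSpace Ω :=
  ⨆ j ∈ Finset.range (n + 1), MeasurableSpace.comap (X (j * h n)) inferInstance

/-- The increments `X_{(j+1) h_n} - X_{j h_n}`, `0 ≤ j < n`. -/
def incr (X : ℝ≥0 → Ω → ℝ) (h : ℕ → ℝ≥0) (n j : ℕ) (ω : Ω) : ℝ :=
  X ((j + 1 : ℕ) * h n) ω - X (j * h n) ω

/-! ### The inverse-Gaussian subordinator; the parameter is `θ = (δ, γ) = (θ 0, θ 1)` -/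

/-- Density of the inverse-Gaussian law `IG(δ, γ)`. -/
def igPDF (δ γ x : ℝ) : ℝ :=
  if 0 < x then
    δ * Real.exp (δ * γ) / √(2 * Real.pi) * x ^ (-3 / 2 : ℝ) *
      Real.exp (-(1 / 2) * (γ ^ 2 * x + δ ^ 2 / x))
  else 0

/-- The inverse-Gaussian law `IG(δ, γ)`. -/
def igMeasure (δ γ : ℝ) : Measure ℝ :=
  volume.withDensity fun x => ENNReal.ofReal (igPDF δ γ x)

/-- `X` is, under `P`, the Lévy process with `X_t ∼ IG(δ t, γ)` for `t > 0`. -/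
structure IsIGSubordinator [MeasurableSpace Ω] (X : ℝ≥0 → Ω → ℝ) (P : Measure Ω) (δ γ : ℝ) : Prop
    extends IsLevyProcess X P where
  law : ∀ t : ℝ≥0, 0 < t → P.map (X t) = igMeasure (δ * t) γ

/-- The log-likelihood of `θ = (δ, γ)` (up to a term free of `θ`, see
`sum_log_igPDF_eq_igLogLik`) based on the increments of `X`. -/
def igLogLik (X : ℝ≥0 → Ω → ℝ) (h : ℕ → ℝ≥0) (n : ℕ) (θ : EuclideanSpace ℝ (Fin 2)) (ω : Ω) : ℝ :=
  ∑ j ∈ Finset.range n,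
    (Real.log (θ 0) + θ 0 * θ 1 * h n -
      1 / 2 * ((θ 0) ^ 2 * (h n : ℝ) ^ 2 / incr X h n j ω + (θ 1) ^ 2 * incr X h n j ω))

lemma log_igPDF {δ γ h x : ℝ} (hδ : 0 < δ) (hh : 0 < h) (hx : 0 < x) :
    Real.log (igPDF (δ * h) γ x) =
      (Real.log δ + δ * γ * h - 1 / 2 * (δ ^ 2 * h ^ 2 / x + γ ^ 2 * x)) +
        (Real.log h - Real.log √(2 * Real.pi) - 3 / 2 * Real.log x) := by
  have h2 : √(2 * Real.pi) ≠ 0 := by positivity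
  have h3 : x ^ (-3 / 2 : ℝ) ≠ 0 := by positivity
  rw [igPDF, if_pos hx, Real.log_mul (by positivity) (by positivity),
    Real.log_mul (by positivity) h3, Real.log_div (by positivity) h2,
    Real.log_mul (by positivity) (by positivity), Real.log_mul hδ.ne' hh.ne', Real.log_exp,
    Real.log_exp, Real.log_rpow hx]
  ring

/-- The sum of the log densities of the (independent) increments is `igLogLik` plus a term that
does not depend on the parameter. -/
lemma sum_log_igPDF_eq_igLogLik (X : ℝ≥0 → Ω → ℝ) (h : ℕ → ℝ≥0) (n : ℕ) (hh : 0 < h n) (ω : Ω)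
    (hx : ∀ j < n, 0 < incr X h n j ω) (θ : EuclideanSpace ℝ (Fin 2)) (hθ : 0 < θ 0) :
    ∑ j ∈ Finset.range n, Real.log (igPDF (θ 0 * h n) (θ 1) (incr X h n j ω)) =
      igLogLik X h n θ ω + ∑ j ∈ Finset.range n,
        (Real.log (h n) - Real.log √(2 * Real.pi) - 3 / 2 * Real.log (incr X h n j ω)) := by
  rw [igLogLik, ← Finset.sum_add_distrib]
  exact Finset.sum_congr rfl fun j hj =>
    log_igPDF hθ (by exact_mod_cast hh) (hx j (Finset.mem_range.1 hj))

/-- `δ̂_n = {n⁻¹ (∑ h_n² / Δ_j X - T_n² / X_{T_n})}^{-1/2}`, where `T_n = n h_n`. -/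
def igDeltaHat (X : ℝ≥0 → Ω → ℝ) (h : ℕ → ℝ≥0) (n : ℕ) (ω : Ω) : ℝ :=
  (√(1 / n * (∑ j ∈ Finset.range n, (h n : ℝ) ^ 2 / incr X h n j ω -
    (n * h n : ℝ) ^ 2 / X (n * h n) ω)))⁻¹

/-- The estimator `θ̂_n = (δ̂_n, γ̂_n)` with `γ̂_n = T_n δ̂_n / X_{T_n}`. -/
def igMLE (X : ℝ≥0 → Ω → ℝ) (h : ℕ → ℝ≥0) (n : ℕ) (ω : Ω) : EuclideanSpace ℝ (Fin 2) :=
  !₂[igDeltaHat X h n ω, n * h n * igDeltaHat X h n ω / X (n * h n) ω]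

/-- Diagonal entries of the rate matrix `A_n = diag(n^{-1/2}, T_n^{-1/2})`. -/
def igRate (h : ℕ → ℝ≥0) (n : ℕ) : Fin 2 → ℝ :=
  ![1 / √(n : ℝ), 1 / √(n * h n : ℝ)]

/-- The Fisher information `diag(2 / δ², δ / γ)`. -/
def igFisher (θ : EuclideanSpace ℝ (Fin 2)) : Matrix (Fin 2) (Fin 2) ℝ :=
  Matrix.diagonal ![2 / (θ 0) ^ 2, θ 0 / θ 1]

/-- The open quadrant `(0, ∞)²`. -/
def posQuadrant : Set (EuclideanSpace ℝ (Fin 2)) := {θ | 0 < θ 0 ∧ 0 < θ 1}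

end General

end

/-! ### Uniform convergence over compact sets via sequences -/

/-! The likelihood depends on the data only through `A = ∑ h²/Δ_j X` and `B = ∑ Δ_j X`, which is
almost surely `X_T`: it equals `n log δ + δγT - (δ²A + γ²B)/2`. Completing the square in `γ` leaves
a one-variable problem in `δ`, whose solution is the estimator (`isMaxOn_quadLogLik`). That `A -
T²/B` is positive is the strict inequality between arithmetic and harmonic means, two increments
being almost surely distinct.

The asymptotics rest on one central limit theorem. A uniform limit over a compact set is a limit
along every sequence `θ_n` of its points, so a triangular array has to be treated. Its rows are
i.i.d. with law `IG(δ_n h_n, γ_n)`. Exponential tilting keeps the inverse-Gaussian family stable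
(`igPDF_mul_exp`), which gives the generating functions of `x` and `1/x`, hence exact first and
second moments and bounds on fourth moments. The standardised score of one observation is centred,
its covariance tends to the identity because `h_n → 0`, and its fourth moment divided by `n` tends
to `0` because `T_n → ∞`. Characteristic functions then converge (`tendsto_charFun_igScore`).

Let `Z_n` be the standardised score. `A` and `B` are affine in the coordinates of `Z_n`, so the
scaled score, the scaled information and the scaled error of the estimator are explicit functions of
`Z_n`. On `{‖Z_n‖ ≤ M}` they differ from a linear map `D_n Z_n`, or from a constant, by a remainder
that tends to `0` uniformly; tightness disposes of the complement. The target Gaussian law moves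
with `θ_n`, but it is the image of the standard one under `D_n`. These maps are Lipschitz with a
common constant, so composing with them keeps the test functions in a fixed bounded-Lipschitz ball
(`tendsto_blDist_of_boundedFilter`). In the quadratic expansion `A` and `B` cancel, and only a
deterministic Taylor remainder of the logarithm survives. -/

lemma tendstoUniformlyOn_zero_of_forall_seq {T : Type*} {K : Set T} {g : ℕ → T → ℝ}
    (H : ∀ θ : ℕ → T, (∀ n, θ n ∈ K) → Tendsto (fun n => g n (θ n)) atTop (𝓝 0)) :
    TendstoUniformlyOn g (fun _ => 0) atTop K := by
  classical
  rcases K.eq_empty_or_nonempty with rfl | ⟨θ₀, hθ₀⟩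
  · exact tendstoUniformlyOn_empty
  rw [Metric.tendstoUniformlyOn_iff]
  intro ε hε
  let p : ℕ → T → Prop := fun n θ => θ ∈ K ∧ ε ≤ |g n θ|
  -- At each stage a point of `K` violating the `ε` bound is selected if there is one; convergence
  -- along this single sequence excludes violations for large `n`.
  let θ : ℕ → T := fun n => if hn : ∃ θ, p n θ then hn.choose else θ₀
  have hK : ∀ n, θ n ∈ K := by
    intro n
    by_cases hn : ∃ θ, p n θ
    · simp only [θ, dif_pos hn]; exact hn.choose_spec.1
    · simp only [θ, dif_neg hn]; exact hθ₀
  have h1 := (Metric.tendsto_nhds.1 (H θ hK)) ε hε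
  filter_upwards [h1] with n hn x hx
  by_contra hcon
  have hex : ∃ θ, p n θ := ⟨x, hx, by simpa [Real.dist_eq, abs_sub_comm] using hcon⟩
  have h2 : ε ≤ |g n (θ n)| := by
    simp only [θ, dif_pos hex]; exact hex.choose_spec.2
  rw [Real.dist_eq, sub_zero] at hn
  linarith

/-! ### Weak convergence and bounded Lipschitz functions -/

section LevyProkhorov

variable {E : Type*} [PseudoMetricSpace E] [MeasurableSpace E] [OpensMeasurableSpace E]

/-- By the layer-cake formula: the `ε`-thickening of a superlevel set of an `L`-Lipschitz function
lies in the superlevel set of the function raised by `L ε`. The shift by `M` makes `f` nonnegative;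
the shift by `L ε` and the error `ε ‖f + M‖ ≤ 2 M ε` give the two terms of the bound. -/
lemma integral_le_of_levyProkhorovEDist_lt_of_lipschitz {μ ν : Measure E} [IsProbabilityMeasure μ]
    [IsProbabilityMeasure ν] {ε : ℝ} (hε : 0 < ε)
    (h : levyProkhorovEDist μ ν < ENNReal.ofReal ε) {f : E → ℝ} {L : ℝ≥0} {M : ℝ}
    (hL : LipschitzWith L f) (hM : ∀ x, |f x| ≤ M) :
    ∫ x, f x ∂μ ≤ ∫ x, f x ∂ν + ε * (L + 2 * M) := by
  rcases isEmpty_or_nonempty E with hE | ⟨⟨x₀⟩⟩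
  · exact absurd (inferInstance : IsEmpty E) (by
      have := nonempty_of_isProbabilityMeasure μ; exact not_isEmpty_of_nonempty E)
  have hM0 : 0 ≤ M := (abs_nonneg _).trans (hM x₀)
  have hbd : ∀ c : ℝ, ∀ x y, dist (f x + c) (f y + c) ≤ 2 * M := fun c x y => by
    rw [dist_add_right, Real.dist_eq]
    have := abs_sub (f x) (f y)
    linarith [hM x, hM y]
  let F : ℝ → BoundedContinuousFunction E ℝ := fun c =>
    BoundedContinuousFunction.mkOfBound ⟨fun x => f x + c, by have := hL.continuous; fun_prop⟩
      (2 * M) (hbd c)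
  have hF : ∀ c x, F c x = f x + c := fun _ _ => rfl
  have hfi : ∀ (κ : Measure E) [IsProbabilityMeasure κ], Integrable f κ := fun κ _ => by
    exact ((F 0).integrable κ).congr (.of_forall fun x => by simp [hF])
  have hF0 : ∀ x, 0 ≤ F M x := fun x => by rw [hF]; linarith [(abs_le.1 (hM x)).1]
  have hG0 : ∀ x, 0 ≤ F (M + L * ε) x := fun x => by
    rw [hF]; have : 0 ≤ L * ε := by positivity
    linarith [(abs_le.1 (hM x)).1]
  have hnorm : ‖F M‖ ≤ 2 * M := by
    refine (BoundedContinuousFunction.norm_le (by positivity)).2 fun x => ?_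
    rw [Real.norm_of_nonneg (hF0 x), hF]; linarith [(abs_le.1 (hM x)).2]
  have hnormle : ‖F M‖ ≤ ‖F (M + L * ε)‖ := by
    refine (BoundedContinuousFunction.norm_le (norm_nonneg _)).2 fun x => ?_
    refine le_trans ?_ ((F (M + L * ε)).norm_coe_le_norm x)
    rw [Real.norm_of_nonneg (hF0 x), Real.norm_of_nonneg (hG0 x), hF, hF]
    have : 0 ≤ L * ε := by positivity
    linarith
  have key := BoundedContinuousFunction.integral_le_of_levyProkhorovEDist_lt μ ν hε h (F M)
    (.of_forall hF0)
  have hint : ∀ (s : ℝ → Set E) (r : ℝ), Antitone s →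
      IntegrableOn (fun t => ν.real (s t)) (Set.Ioc 0 r) := fun s r hs => by
    apply Measure.integrableOn_of_bounded (M := 1) measure_Ioc_lt_top.ne
    · exact (Measurable.ennreal_toReal
        (Antitone.measurable fun _ _ hst => measure_mono (hs hst))).aestronglyMeasurable
    · refine Eventually.of_forall fun t => ?_
      simp only [Real.norm_eq_abs, abs_of_nonneg measureReal_nonneg]
      exact measureReal_le_one
  have h1 : (∫ t in Set.Ioc 0 ‖F M‖, ν.real (Metric.thickening ε {a | t ≤ F M a})) ≤
      ∫ x, F (M + L * ε) x ∂ν := by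
    rw [BoundedContinuousFunction.integral_eq_integral_meas_le _ ν (.of_forall hG0)]
    have hanti : Antitone fun t : ℝ => {a | t ≤ F (M + L * ε) a} :=
      fun _ _ hst _ ha => le_trans hst ha
    refine le_trans (setIntegral_mono (g := fun t => ν.real {a | t ≤ F (M + L * ε) a})
      (hint _ _ fun _ _ hst => Metric.thickening_subset_of_subset _ fun _ ha => le_trans hst ha)
      (hint _ _ hanti) fun t => ?_) ?_
    · refine measureReal_mono fun x hx => ?_
      obtain ⟨y, hy, hxy⟩ := Metric.mem_thickening_iff.1 hx
      have h2 := hL.dist_le_mul y x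
      simp only [Set.mem_ofPred_eq, hF] at hy ⊢
      have h3 : f y - f x ≤ L * dist y x := (le_abs_self _).trans h2
      have h4 : L * dist y x ≤ L * ε := by
        rw [dist_comm]; gcongr
      linarith
    · exact setIntegral_mono_set (hint _ _ hanti) (.of_forall fun _ => measureReal_nonneg)
        (Set.Ioc_subset_Ioc_right hnormle).eventuallyLE
  have e1 : ∫ x, F M x ∂μ = ∫ x, f x ∂μ + M := by
    simp_rw [hF]; rw [integral_add (hfi μ) (integrable_const _)]; simp
  have e2 : ∫ x, F (M + L * ε) x ∂ν = ∫ x, f x ∂ν + (M + L * ε) := by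
    simp_rw [hF]; rw [integral_add (hfi ν) (integrable_const _)]; simp
  have h5 : ε * ‖F M‖ ≤ ε * (2 * M) := by gcongr
  linarith

lemma abs_integral_sub_le_of_levyProkhorovEDist_lt {μ ν : Measure E} [IsProbabilityMeasure μ]
    [IsProbabilityMeasure ν] {ε : ℝ} (hε : 0 < ε)
    (h : levyProkhorovEDist μ ν < ENNReal.ofReal ε) {f : E → ℝ} {L : ℝ≥0} {M : ℝ}
    (hL : LipschitzWith L f) (hM : ∀ x, |f x| ≤ M) :
    |∫ x, f x ∂μ - ∫ x, f x ∂ν| ≤ ε * (L + 2 * M) := by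
  have h1 := integral_le_of_levyProkhorovEDist_lt_of_lipschitz hε h hL hM
  have h2 := integral_le_of_levyProkhorovEDist_lt_of_lipschitz hε
    ((levyProkhorovEDist_comm ν μ).trans_lt h) hL hM
  exact abs_sub_le_iff.2 ⟨by linarith, by linarith⟩

lemma tendsto_levyProkhorovEDist [TopologicalSpace.SeparableSpace E]
    {μ : ℕ → ProbabilityMeasure E} {ν : ProbabilityMeasure E} (h : Tendsto μ atTop (𝓝 ν)) {ε : ℝ}
    (hε : 0 < ε) :
    ∀ᶠ n in atTop, levyProkhorovEDist (μ n : Measure E) ν < ENNReal.ofReal ε := by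
  have h1 := (LevyProkhorov.continuous_ofMeasure_probabilityMeasure.tendsto ν).comp h
  filter_upwards [(Metric.tendsto_nhds.1 h1) ε hε] with n hn
  rw [Function.comp_apply, LevyProkhorov.dist_probabilityMeasure_def, levyProkhorovDist] at hn
  exact (ENNReal.lt_ofReal_iff_toReal_lt (levyProkhorovEDist_ne_top _ _)).2 hn

end LevyProkhorov

/-! ### Convergence uniform over the event that a random vector is bounded -/

section BoundedFilter

variable {Ω E : Type*} [NormedAddCommGroup E]

/-- The filter on `ℕ × Ω` of the sets that contain `(n, ω)` for all large `n` and all `ω` with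
`‖Z n ω‖ ≤ M`. -/
def boundedFilter (Z : ℕ → Ω → E) (M : ℝ) : Filter (ℕ × Ω) :=
  comap Prod.fst atTop ⊓ 𝓟 {p | ‖Z p.1 p.2‖ ≤ M}

lemma eventually_boundedFilter {Z : ℕ → Ω → E} {M : ℝ} {p : ℕ × Ω → Prop} :
    (∀ᶠ x in boundedFilter Z M, p x) ↔ ∀ᶠ n in atTop, ∀ ω, ‖Z n ω‖ ≤ M → p (n, ω) := by
  rw [boundedFilter, eventually_inf_principal, eventually_comap]
  refine eventually_congr (.of_forall fun n => ⟨fun h ω hω => h (n, ω) rfl hω, ?_⟩)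
  rintro h ⟨m, ω⟩ rfl hω
  exact h ω hω

lemma tendsto_fst_boundedFilter {Z : ℕ → Ω → E} {M : ℝ} :
    Tendsto Prod.fst (boundedFilter Z M) atTop :=
  tendsto_comap.mono_left inf_le_left

end BoundedFilter

/-! ### Slutsky-type transfer from a tight sequence to its functions -/

section Slutsky

variable {Ω : Type*} [MeasurableSpace Ω]

lemma blDist_nonneg {E : Type*} [PseudoEMetricSpace E] [MeasurableSpace E]
    (P : Measure Ω) (ζ : Ω → E) (ν : Measure E) : 0 ≤ blDist P ζ ν := by
  refine Real.sSup_nonneg ?_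
  rintro r ⟨f, -, rfl⟩
  exact abs_nonneg _

lemma probDist_nonneg (P : Measure Ω) (ζ : Ω → ℝ) (c : ℝ) : 0 ≤ probDist P ζ c :=
  integral_nonneg fun _ => by positivity

lemma integral_le_add_measureReal {P : Measure Ω} [IsProbabilityMeasure P] {f : Ω → ℝ} {s : Set Ω}
    (hs : MeasurableSet s) {ε B : ℝ} (hε : 0 ≤ ε) (h1 : ∀ ω ∉ s, f ω ≤ ε)
    (h2 : ∀ ω, f ω ≤ B) (hB : 0 ≤ B) :
    ∫ ω, f ω ∂P ≤ ε + B * P.real s := by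
  -- No measurability of `f` is assumed: a non-integrable `f` has Bochner integral `0`, which
  -- satisfies the bound.
  by_cases hf : Integrable f P
  · calc ∫ ω, f ω ∂P ≤ ∫ ω, (ε + s.indicator (fun _ => B) ω) ∂P := by
          refine integral_mono hf ((integrable_const _).add
            ((integrable_const _).indicator hs)) fun ω => ?_
          by_cases hω : ω ∈ s
          · simp only [Set.indicator_of_mem hω]; linarith [h2 ω]
          · simp only [Set.indicator_of_notMem hω]; linarith [h1 ω hω]
      _ = ε + B * P.real s := by
          rw [integral_add (integrable_const _) ((integrable_const _).indicator hs),
            integral_indicator_const _ hs]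
          simp [mul_comm]
  · rw [integral_undef hf]; positivity

variable {E : Type*} [NormedAddCommGroup E]

/-- Random vectors `Z n` under `P n` form a tight sequence. -/
def TightSeq (P : ℕ → Measure Ω) (Z : ℕ → Ω → E) : Prop :=
  ∀ ε > 0, ∃ M : ℝ, ∀ n, (P n).real {ω | M < ‖Z n ω‖} ≤ ε

variable [MeasurableSpace E] [BorelSpace E] {P : ℕ → Measure Ω} {Z : ℕ → Ω → E}

/-- The integrand of `probDist` is at most `1`, so the event `‖Z n‖ > M` costs its probability only;
elsewhere the integrand is at most `|ζ n - c n|`. -/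
lemma tendsto_probDist_of_boundedFilter (hP : ∀ n, IsProbabilityMeasure (P n))
    (hZ : ∀ n, Measurable (Z n)) (hT : TightSeq P Z) {ζ : ℕ → Ω → ℝ} {c : ℕ → ℝ}
    (H : ∀ M, Tendsto (fun p : ℕ × Ω => ζ p.1 p.2 - c p.1) (boundedFilter Z M) (𝓝 0)) :
    Tendsto (fun n => probDist (P n) (ζ n) (c n)) atTop (𝓝 0) := by
  rw [Metric.tendsto_nhds]
  intro ε hε
  obtain ⟨M, hM⟩ := hT (ε / 3) (by positivity)
  have h1 := eventually_boundedFilter.1 (Metric.tendsto_nhds.1 (H M) (ε / 3) (by positivity))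
  filter_upwards [h1] with n hn
  rw [Real.dist_eq, sub_zero, abs_of_nonneg (probDist_nonneg _ _ _)]
  have := integral_le_add_measureReal (P := P n) (s := {ω | M < ‖Z n ω‖})
    (f := fun ω => |ζ n ω - c n| / (1 + |ζ n ω - c n|)) (ε := ε / 3) (B := 1)
    (measurableSet_lt measurable_const (hZ n).norm) (by positivity) (fun ω hω => ?_)
    (fun ω => div_le_one_of_le₀ (by linarith) (by positivity)) zero_le_one
  · rw [probDist]; linarith [hM n]
  · have h2 := hn ω (not_lt.1 hω)
    rw [Real.dist_eq, sub_zero] at h2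
    exact (div_le_self (abs_nonneg _) (by linarith [abs_nonneg (ζ n ω - c n)])).trans h2.le

/-- Both the map `D n` and the target law may vary with `n`. The Lévy–Prokhorov estimate is applied
to `f ∘ D n`, whose Lipschitz constant is at most `L` for every `f` in the unit ball, so the bound
is uniform in `f`. -/
lemma tendsto_blDist_of_boundedFilter [SecondCountableTopology E]
    (hP : ∀ n, IsProbabilityMeasure (P n)) (hZ : ∀ n, Measurable (Z n)) (hT : TightSeq P Z)
    {ν : ProbabilityMeasure E}
    (hν : ∀ ε > 0, ∀ᶠ n in atTop, levyProkhorovEDist ((P n).map (Z n)) ν < ENNReal.ofReal ε)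
    {F : Type*} [NormedAddCommGroup F] [MeasurableSpace F] [BorelSpace F]
    {ζ : ℕ → Ω → F} (hζ : ∀ᶠ n in atTop, AEStronglyMeasurable (ζ n) (P n))
    {D : ℕ → E → F} {L : ℝ≥0} (hD : ∀ n, LipschitzWith L (D n))
    (H : ∀ M, Tendsto (fun p : ℕ × Ω => ζ p.1 p.2 - D p.1 (Z p.1 p.2)) (boundedFilter Z M)
      (𝓝 0)) :
    Tendsto (fun n => blDist (P n) (ζ n) ((ν : Measure E).map (D n))) atTop (𝓝 0) := by
  rw [Metric.tendsto_nhds]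
  intro ε hε
  obtain ⟨M, hM⟩ := hT (ε / 8) (by positivity)
  have h1 := eventually_boundedFilter.1 (Metric.tendsto_nhds.1 (H M) (ε / 4) (by positivity))
  -- The radius is such that radius times `L + 2 · 1` equals `ε / 4`. The budget is `ε / 4` here, `ε
  -- / 4` for the remainder on the bounded event, and `2 · ε / 8` off it.
  filter_upwards [h1, hν (ε / (4 * (L + 2))) (by positivity), hζ] with n hn hn2 hζn
  rw [Real.dist_eq, sub_zero, abs_of_nonneg (blDist_nonneg _ _ _)]
  refine lt_of_le_of_lt (b := 3 / 4 * ε) (Real.sSup_le ?_ (by positivity)) (by linarith)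
  rintro r ⟨f, ⟨L', M', hfL, hfM, hLM⟩, rfl⟩
  have hL' : L' ≤ 1 := le_trans le_self_add hLM
  have hM' : M' ≤ 1 := le_trans le_add_self hLM
  have hf1 : ∀ x, |f x| ≤ 1 := fun x => (hfM x).trans (by exact_mod_cast hM')
  have hg : LipschitzWith L (f ∘ D n) := by
    refine (hfL.comp (hD n)).weaken ?_
    calc L' * L ≤ 1 * L := by gcongr
      _ = L := one_mul L
  have : IsProbabilityMeasure ((P n).map (Z n)) :=
    Measure.isProbabilityMeasure_map (hZ n).aemeasurable
  have h3 := abs_integral_sub_le_of_levyProkhorovEDist_lt (by positivity) hn2 hg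
    (M := 1) (fun x => hf1 _)
  have e1 : ∫ x, (f ∘ D n) x ∂((P n).map (Z n)) = ∫ ω, f (D n (Z n ω)) ∂(P n) :=
    integral_map (hZ n).aemeasurable hg.continuous.measurable.aestronglyMeasurable
  have e2 : ∫ x, f x ∂((ν : Measure E).map (D n)) = ∫ x, (f ∘ D n) x ∂(ν : Measure E) :=
    integral_map (hD n).continuous.measurable.aemeasurable
      hfL.continuous.measurable.aestronglyMeasurable
  have i1 : Integrable (fun ω => f (ζ n ω)) (P n) :=
    .of_bound (hfL.continuous.comp_aestronglyMeasurable hζn) 1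
      (.of_forall fun ω => by simpa using hf1 _)
  have i2 : Integrable (fun ω => f (D n (Z n ω))) (P n) :=
    .of_bound (hg.continuous.measurable.comp (hZ n)).aestronglyMeasurable 1
      (.of_forall fun ω => by simpa using hf1 _)
  have h4 : |∫ ω, f (ζ n ω) ∂(P n) - ∫ ω, f (D n (Z n ω)) ∂(P n)| ≤ ε / 4 + 2 * (ε / 8) := by
    rw [← integral_sub i1 i2]
    refine abs_integral_le_integral_abs.trans ?_
    refine (integral_le_add_measureReal (s := {ω | M < ‖Z n ω‖}) (ε := ε / 4) (B := 2)
      (measurableSet_lt measurable_const (hZ n).norm) (by positivity) (fun ω hω => ?_)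
      (fun ω => (abs_sub _ _).trans (by linarith [hf1 (ζ n ω), hf1 (D n (Z n ω))]))
      (by norm_num)).trans (by linarith [hM n])
    have h5 := hn ω (not_lt.1 hω)
    have h6 := hfL.dist_le_mul (ζ n ω) (D n (Z n ω))
    rw [dist_zero_right] at h5
    rw [Real.dist_eq, dist_eq_norm] at h6
    have h7 : (L' : ℝ) ≤ 1 := by exact_mod_cast hL'
    nlinarith [norm_nonneg (ζ n ω - D n (Z n ω))]
  rw [e1] at h3
  rw [e2]
  have h8 : ε / (4 * ((L : ℝ) + 2)) * (L + 2 * 1) = ε / 4 := by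
    field_simp
  rw [h8] at h3
  calc _ ≤ _ := abs_sub_le _ (∫ ω, f (D n (Z n ω)) ∂(P n)) _
    _ ≤ 3 / 4 * ε := by linarith

end Slutsky

/-! ### Lévy continuity: tightness and weak convergence from characteristic functions -/

section Levy

variable {Ω : Type*} [MeasurableSpace Ω] {E : Type*} [NormedAddCommGroup E]
  [InnerProductSpace ℝ E] [FiniteDimensional ℝ E] [MeasurableSpace E] [BorelSpace E]
  {P : ℕ → Measure Ω} {Z : ℕ → Ω → E} {ν : ProbabilityMeasure E}

lemma tightSeq_of_tendsto_charFun (hP : ∀ n, IsProbabilityMeasure (P n))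
    (hZ : ∀ n, Measurable (Z n))
    (H : ∀ t, Tendsto (fun n => charFun ((P n).map (Z n)) t) atTop (𝓝 (charFun ν t))) :
    TightSeq P Z := by
  have : ∀ n, IsProbabilityMeasure ((P n).map (Z n)) := fun n =>
    Measure.isProbabilityMeasure_map (hZ n).aemeasurable
  have h1 := isTightMeasureSet_of_tendsto_charFun (μ := fun n => (P n).map (Z n))
    (f := charFun ν) (by fun_prop) H
  rw [isTightMeasureSet_iff_exists_isCompact_measure_compl_le] at h1
  intro ε hε
  obtain ⟨K, hK, h2⟩ := h1 (ENNReal.ofReal ε) (by simpa using hε)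
  obtain ⟨M, hM⟩ := hK.isBounded.exists_norm_le
  refine ⟨M, fun n => ?_⟩
  have h3 := h2 _ ⟨n, rfl⟩
  simp only at h3
  rw [Measure.map_apply (hZ n) hK.isClosed.measurableSet.compl] at h3
  refine ENNReal.toReal_le_of_le_ofReal hε.le ((measure_mono fun ω hω => ?_).trans h3)
  intro hω'
  exact absurd (hM _ hω') (not_le.2 hω)

lemma eventually_levyProkhorovEDist_lt_of_tendsto_charFun (hP : ∀ n, IsProbabilityMeasure (P n))
    (hZ : ∀ n, Measurable (Z n))
    (H : ∀ t, Tendsto (fun n => charFun ((P n).map (Z n)) t) atTop (𝓝 (charFun ν t))) {ε : ℝ}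
    (hε : 0 < ε) :
    ∀ᶠ n in atTop, levyProkhorovEDist ((P n).map (Z n)) ν < ENNReal.ofReal ε :=
  tendsto_levyProkhorovEDist (μ := fun n => ⟨(P n).map (Z n),
    Measure.isProbabilityMeasure_map (hZ n).aemeasurable⟩)
    (ProbabilityMeasure.tendsto_of_tendsto_charFun H) hε

end Levy

/-! ### The inverse-Gaussian law -/

section InverseGaussian

/-- The integral of `exp (-t² / 2)` from `0` to `y`. -/
noncomputable def gaussInt (y : ℝ) : ℝ := ∫ t in (0 : ℝ)..y, Real.exp (-(1 / 2) * t ^ 2)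

lemma hasDerivAt_gaussInt (y : ℝ) : HasDerivAt gaussInt (Real.exp (-(1 / 2) * y ^ 2)) y :=
  have hc : Continuous fun t : ℝ => Real.exp (-(1 / 2) * t ^ 2) := by fun_prop
  intervalIntegral.integral_hasDerivAt_right (hc.intervalIntegrable _ _)
    hc.aestronglyMeasurable.stronglyMeasurableAtFilter hc.continuousAt

lemma tendsto_gaussInt_atTop : Tendsto gaussInt atTop (𝓝 (√(2 * Real.pi) / 2)) := by
  have h := intervalIntegral_tendsto_integral_Ioi 0
    (integrable_exp_neg_mul_sq (b := 1 / 2) (by norm_num)).integrableOn tendsto_id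
  rw [integral_gaussian_Ioi] at h
  convert! h using 3
  congr 1
  ring

lemma gaussInt_neg (y : ℝ) : gaussInt (-y) = -gaussInt y := by
  have h := intervalIntegral.integral_comp_neg (a := 0) (b := y)
    (fun t : ℝ => Real.exp (-(1 / 2) * t ^ 2))
  simp only [even_two.neg_pow, neg_zero] at h
  rw [gaussInt, gaussInt, h, intervalIntegral.integral_symm]

lemma tendsto_gaussInt_atBot : Tendsto gaussInt atBot (𝓝 (-(√(2 * Real.pi) / 2))) := by
  have h := (tendsto_gaussInt_atTop.comp tendsto_neg_atBot_atTop).neg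
  refine h.congr fun y => ?_
  simp [gaussInt_neg]

/-- A primitive of `√(2π)` times the density of `IG(d, γ)`. -/
noncomputable def igPrimitive (d γ x : ℝ) : ℝ :=
  gaussInt (γ * √x - d / √x) + Real.exp (2 * d * γ) * gaussInt (-γ * √x - d / √x)

lemma rpow_neg_three_halves {x : ℝ} (hx : 0 < x) : x ^ (-3 / 2 : ℝ) = 1 / √x ^ 3 := by
  rw [Real.sqrt_eq_rpow, ← Real.rpow_natCast (x ^ (1 / 2 : ℝ)) 3, ← Real.rpow_mul hx.le, one_div,
    ← Real.rpow_neg hx.le]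
  norm_num

/-- The factor `exp (2dγ)` gives both Gaussian terms the same exponential, and in the sum of the
inner derivatives the terms in `γ` cancel, leaving `d x^(-3/2)`. -/
lemma hasDerivAt_igPrimitive (d γ : ℝ) {x : ℝ} (hx : 0 < x) :
    HasDerivAt (igPrimitive d γ) (√(2 * Real.pi) * igPDF d γ x) x := by
  have hs : 0 < √x := Real.sqrt_pos.2 hx
  have h1 := Real.hasDerivAt_sqrt hx.ne'
  have hu : ∀ c : ℝ, HasDerivAt (fun x => c * √x - d / √x)
      (c * (1 / (2 * √x)) - (0 * √x - d * (1 / (2 * √x))) / √x ^ 2) x := fun c =>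
    (h1.const_mul c).sub ((hasDerivAt_const x d).div h1 hs.ne')
  have h2 := ((hasDerivAt_gaussInt _).comp x (hu γ)).add
    (((hasDerivAt_gaussInt _).comp x (hu (-γ))).const_mul (Real.exp (2 * d * γ)))
  refine h2.congr_deriv ?_
  have hpi : √(2 * Real.pi) ≠ 0 := by positivity
  have hxs : x = √x ^ 2 := (Real.sq_sqrt hx.le).symm
  have e0 : Real.exp (d * γ) * Real.exp (-(1 / 2) * (γ ^ 2 * x + d ^ 2 / x)) =
      Real.exp (-(1 / 2) * (γ * √x - d / √x) ^ 2) := by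
    rw [← Real.exp_add]
    congr 1
    rw [sub_sq, mul_pow, div_pow, ← hxs]
    field_simp
    ring
  have e1 : Real.exp (2 * d * γ) * Real.exp (-(1 / 2) * (-γ * √x - d / √x) ^ 2) =
      Real.exp (-(1 / 2) * (γ * √x - d / √x) ^ 2) := by
    rw [← Real.exp_add]
    congr 1
    field_simp
    ring
  rw [igPDF, if_pos hx, rpow_neg_three_halves hx, ← mul_assoc (Real.exp (2 * d * γ)), e1]
  calc _ = d * (1 / √x ^ 3) * Real.exp (-(1 / 2) * (γ * √x - d / √x) ^ 2) := by
        field_simp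
        ring
    _ = _ := by
        rw [← e0]
        field_simp

lemma tendsto_igPrimitive_atTop (d : ℝ) {γ : ℝ} (hγ : 0 < γ) :
    Tendsto (igPrimitive d γ) atTop
      (𝓝 (√(2 * Real.pi) / 2 + Real.exp (2 * d * γ) * -(√(2 * Real.pi) / 2))) := by
  have h0 : Tendsto (fun x : ℝ => d / √x) atTop (𝓝 0) :=
    tendsto_const_nhds.div_atTop Real.tendsto_sqrt_atTop
  refine (tendsto_gaussInt_atTop.comp ?_).add ((tendsto_gaussInt_atBot.comp ?_).const_mul _)
  · exact (Real.tendsto_sqrt_atTop.const_mul_atTop hγ).atTop_add h0.neg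
  · exact (Real.tendsto_sqrt_atTop.const_mul_atTop_of_neg (by linarith)).atBot_add h0.neg

lemma tendsto_igPrimitive_zero {d : ℝ} (γ : ℝ) (hd : 0 < d) :
    Tendsto (igPrimitive d γ) (𝓝[>] 0)
      (𝓝 (-(√(2 * Real.pi) / 2) + Real.exp (2 * d * γ) * -(√(2 * Real.pi) / 2))) := by
  have hs : Tendsto (fun x : ℝ => √x) (𝓝[>] 0) (𝓝 0) := by
    simpa using! (Real.continuous_sqrt.tendsto 0).mono_left nhdsWithin_le_nhds
  have hs' : Tendsto (fun x : ℝ => √x) (𝓝[>] 0) (𝓝[>] 0) :=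
    tendsto_nhdsWithin_iff.2 ⟨hs, by
      filter_upwards [self_mem_nhdsWithin] with x hx using Real.sqrt_pos.2 hx⟩
  have h0 : Tendsto (fun x : ℝ => -(d / √x)) (𝓝[>] 0) atBot := by
    refine tendsto_neg_atTop_atBot.comp ?_
    simpa only [div_eq_mul_inv] using! (tendsto_inv_nhdsGT_zero.comp hs').const_mul_atTop hd
  have h1 : ∀ c : ℝ, Tendsto (fun x : ℝ => c * √x - d / √x) (𝓝[>] 0) atBot := fun c =>
    (by simpa using! hs.const_mul c : Tendsto (fun x : ℝ => c * √x) (𝓝[>] 0) (𝓝 0)).add_atBot h0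
  exact (tendsto_gaussInt_atBot.comp (h1 γ)).add
    ((tendsto_gaussInt_atBot.comp (h1 (-γ))).const_mul _)

lemma igPDF_nonneg {d : ℝ} (hd : 0 ≤ d) (γ x : ℝ) : 0 ≤ igPDF d γ x := by
  unfold igPDF
  split_ifs with hx
  · positivity
  · exact le_rfl

lemma measurable_igPDF (d γ : ℝ) : Measurable (igPDF d γ) := by
  unfold igPDF
  refine Measurable.ite measurableSet_Ioi ?_ measurable_const
  fun_prop

/-- The fundamental theorem of calculus on the half-line: the limits of the primitive at `∞` and at
`0` share the term carrying `exp (2dγ)`, and differ by `√(2π)`. -/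
lemma integrableOn_integral_igPDF {d γ : ℝ} (hd : 0 < d) (hγ : 0 < γ) :
    IntegrableOn (igPDF d γ) (Set.Ioi 0) ∧ ∫ x in Set.Ioi 0, igPDF d γ x = 1 := by
  set A : ℝ := -(√(2 * Real.pi) / 2) + Real.exp (2 * d * γ) * -(√(2 * Real.pi) / 2) with hA
  have hpi : 0 < √(2 * Real.pi) := by positivity
  -- At `0` the primitive takes a value produced by `d / √0 = 0`, so it is replaced there by its
  -- right limit.
  have hc : ContinuousWithinAt (Function.update (igPrimitive d γ) 0 A) (Set.Ici 0) 0 := by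
    rw [continuousWithinAt_update_same, Set.Ici_sdiff_left]
    exact tendsto_igPrimitive_zero γ hd
  have hder : ∀ x ∈ Set.Ioi (0 : ℝ), HasDerivAt (Function.update (igPrimitive d γ) 0 A)
      (√(2 * Real.pi) * igPDF d γ x) x := fun x hx =>
    (hasDerivAt_igPrimitive d γ hx).congr_of_eventuallyEq (by
      filter_upwards [eventually_ne_nhds (ne_of_gt hx)] with y hy
      rw [Function.update_of_ne hy])
  have hlim : Tendsto (Function.update (igPrimitive d γ) 0 A) atTop
      (𝓝 (√(2 * Real.pi) / 2 + Real.exp (2 * d * γ) * -(√(2 * Real.pi) / 2))) :=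
    (tendsto_igPrimitive_atTop d hγ).congr' (by
      filter_upwards [eventually_ne_atTop 0] with y hy
      rw [Function.update_of_ne hy])
  have hnn : ∀ x ∈ Set.Ioi (0 : ℝ), 0 ≤ √(2 * Real.pi) * igPDF d γ x := fun x _ =>
    mul_nonneg hpi.le (igPDF_nonneg hd.le _ _)
  have h1 := integrableOn_Ioi_deriv_of_nonneg hc hder hnn hlim
  have h2 := integral_Ioi_of_hasDerivAt_of_nonneg hc hder hnn hlim
  constructor
  · exact (h1.const_mul (√(2 * Real.pi))⁻¹).congr (.of_forall fun x => by field_simp)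
  · rw [integral_const_mul, Function.update_self] at h2
    have : √(2 * Real.pi) * ∫ x in Set.Ioi 0, igPDF d γ x = √(2 * Real.pi) * 1 := by
      rw [h2, hA]; ring
    exact mul_left_cancel₀ hpi.ne' this

lemma igPDF_of_nonpos {d γ x : ℝ} (hx : x ≤ 0) : igPDF d γ x = 0 := if_neg (not_lt.2 hx)

lemma integrable_igPDF {d γ : ℝ} (hd : 0 < d) (hγ : 0 < γ) : Integrable (igPDF d γ) :=
  (integrableOn_iff_integrable_of_support_subset fun x hx => by
    by_contra h
    exact hx (igPDF_of_nonpos (not_lt.1 h))).1 (integrableOn_integral_igPDF hd hγ).1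

lemma integral_igPDF {d γ : ℝ} (hd : 0 < d) (hγ : 0 < γ) : ∫ x, igPDF d γ x = 1 := by
  rw [← (integrableOn_integral_igPDF hd hγ).2, setIntegral_eq_integral_of_forall_compl_eq_zero]
  exact fun x hx => igPDF_of_nonpos (not_lt.1 hx)

lemma isProbabilityMeasure_igMeasure {d γ : ℝ} (hd : 0 < d) (hγ : 0 < γ) :
    IsProbabilityMeasure (igMeasure d γ) := by
  refine ⟨?_⟩
  rw [igMeasure, withDensity_apply _ .univ, setLIntegral_univ,
    ← ofReal_integral_eq_lintegral_ofReal (integrable_igPDF hd hγ)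
    (.of_forall fun x => igPDF_nonneg hd.le _ _), integral_igPDF hd hγ, ENNReal.ofReal_one]

lemma ae_pos_igMeasure (d γ : ℝ) : ∀ᵐ x ∂(igMeasure d γ), 0 < x := by
  rw [igMeasure, ae_withDensity_iff (measurable_igPDF d γ).ennreal_ofReal]
  refine .of_forall fun x hx => ?_
  by_contra h
  exact hx (by rw [igPDF_of_nonpos (not_lt.1 h), ENNReal.ofReal_zero])

lemma integral_igMeasure {d : ℝ} (hd : 0 ≤ d) (γ : ℝ) (f : ℝ → ℝ) :
    ∫ x, f x ∂(igMeasure d γ) = ∫ x, igPDF d γ x * f x := by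
  rw [igMeasure, integral_withDensity_eq_integral_toReal_smul
    (measurable_igPDF d γ).ennreal_ofReal (.of_forall fun _ => ENNReal.ofReal_lt_top)]
  simp [ENNReal.toReal_ofReal (igPDF_nonneg hd γ _)]

lemma integrable_igMeasure_iff {d : ℝ} (hd : 0 ≤ d) (γ : ℝ) (f : ℝ → ℝ) :
    Integrable f (igMeasure d γ) ↔ Integrable fun x => igPDF d γ x * f x := by
  rw [igMeasure, integrable_withDensity_iff_integrable_smul'
    (measurable_igPDF d γ).ennreal_ofReal (.of_forall fun _ => ENNReal.ofReal_lt_top)]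
  simp [ENNReal.toReal_ofReal (igPDF_nonneg hd γ _)]

/-- Exponential tilting of an inverse-Gaussian density is inverse-Gaussian. -/
lemma igPDF_mul_exp {d γ a b : ℝ} (hb : 2 * b < d ^ 2) (ha : 2 * a < γ ^ 2) (x : ℝ) :
    igPDF d γ x * Real.exp (a * x + b / x) =
      d / √(d ^ 2 - 2 * b) * Real.exp (d * γ - √(d ^ 2 - 2 * b) * √(γ ^ 2 - 2 * a)) *
        igPDF √(d ^ 2 - 2 * b) √(γ ^ 2 - 2 * a) x := by
  unfold igPDF
  split_ifs with hx
  · have hd' : 0 < √(d ^ 2 - 2 * b) := Real.sqrt_pos.2 (by linarith)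
    rw [Real.sq_sqrt (by linarith), Real.sq_sqrt (by linarith)]
    have e : Real.exp (d * γ) * Real.exp (-(1 / 2) * (γ ^ 2 * x + d ^ 2 / x)) *
        Real.exp (a * x + b / x) =
        Real.exp (d * γ - √(d ^ 2 - 2 * b) * √(γ ^ 2 - 2 * a)) *
        Real.exp (√(d ^ 2 - 2 * b) * √(γ ^ 2 - 2 * a)) *
        Real.exp (-(1 / 2) * ((γ ^ 2 - 2 * a) * x + (d ^ 2 - 2 * b) / x)) := by
      simp only [← Real.exp_add]
      congr 1
      ring
    calc _ = d / √(2 * Real.pi) * x ^ (-3 / 2 : ℝ) *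
          (Real.exp (d * γ) * Real.exp (-(1 / 2) * (γ ^ 2 * x + d ^ 2 / x)) *
            Real.exp (a * x + b / x)) := by ring
      _ = _ := by
          rw [e]
          field_simp
  · simp

lemma integrable_exp_igMeasure {d γ a b : ℝ} (hd : 0 < d) (hb : 2 * b < d ^ 2)
    (ha : 2 * a < γ ^ 2) :
    Integrable (fun x => Real.exp (a * x + b / x)) (igMeasure d γ) := by
  rw [integrable_igMeasure_iff hd.le]
  simp_rw [igPDF_mul_exp hb ha]
  exact (integrable_igPDF (Real.sqrt_pos.2 (by linarith))
    (Real.sqrt_pos.2 (by linarith))).const_mul _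

/-- The tilted density has total mass one, so only the normalising factor remains; `b = 0` and `a =
0` give the generating functions of `x` and of `1/x`. -/
lemma integral_exp_igMeasure {d γ a b : ℝ} (hd : 0 < d) (hb : 2 * b < d ^ 2)
    (ha : 2 * a < γ ^ 2) :
    ∫ x, Real.exp (a * x + b / x) ∂(igMeasure d γ) =
      d / √(d ^ 2 - 2 * b) * Real.exp (d * γ - √(d ^ 2 - 2 * b) * √(γ ^ 2 - 2 * a)) := by
  rw [integral_igMeasure hd.le]
  simp_rw [igPDF_mul_exp hb ha]
  rw [integral_const_mul, integral_igPDF (Real.sqrt_pos.2 (by linarith))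
    (Real.sqrt_pos.2 (by linarith)), mul_one]

end InverseGaussian

/-! ### Moments of the inverse-Gaussian law -/

section Moments

variable {Ω : Type*} [MeasurableSpace Ω]

lemma mem_interior_integrableExpSet_of_lt {μ : Measure Ω} {Y : Ω → ℝ} {c : ℝ}
    (hint : ∀ t < c, Integrable (fun ω => Real.exp (t * Y ω)) μ) {t : ℝ} (ht : t < c) :
    t ∈ interior (integrableExpSet Y μ) :=
  interior_maximal (fun s hs => hint s hs) isOpen_Iio ht

lemma integrable_pow_of_exp {μ : Measure Ω} {Y : Ω → ℝ} {c : ℝ} (hc : 0 < c)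
    (hint : ∀ t < c, Integrable (fun ω => Real.exp (t * Y ω)) μ) (n : ℕ) :
    Integrable (fun ω => Y ω ^ n) μ :=
  integrable_pow_of_mem_interior_integrableExpSet
    (mem_interior_integrableExpSet_of_lt hint hc) n

/-- The first two moments from an explicit moment generating function. -/
lemma integral_of_hasDerivAt_mgf {μ : Measure Ω} {Y : Ω → ℝ} {c : ℝ} (hc : 0 < c)
    (hint : ∀ t < c, Integrable (fun ω => Real.exp (t * Y ω)) μ) {f f₁ : ℝ → ℝ} {f₂ : ℝ}
    (hf : ∀ t < c, ∫ ω, Real.exp (t * Y ω) ∂μ = f t) (h1 : ∀ t < c, HasDerivAt f (f₁ t) t)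
    (h2 : HasDerivAt f₁ f₂ 0) :
    ∫ ω, Y ω ∂μ = f₁ 0 ∧ ∫ ω, Y ω ^ 2 ∂μ = f₂ := by
  have e1 : ∀ t < c, ∫ ω, Y ω * Real.exp (t * Y ω) ∂μ = f₁ t := fun t ht => by
    have h3 := hasDerivAt_integral_pow_mul_exp_real
      (mem_interior_integrableExpSet_of_lt hint ht) 0
    simp only [pow_zero, one_mul, zero_add, pow_one] at h3
    refine h3.unique ((h1 t ht).congr_of_eventuallyEq ?_)
    filter_upwards [Iio_mem_nhds ht] with s hs using hf s hs
  have h4 := hasDerivAt_integral_pow_mul_exp_real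
    (mem_interior_integrableExpSet_of_lt hint hc) 1
  simp only [pow_one, Nat.reduceAdd, zero_mul, Real.exp_zero, mul_one] at h4
  refine ⟨by simpa using e1 0 hc, h4.unique (h2.congr_of_eventuallyEq ?_)⟩
  filter_upwards [Iio_mem_nhds hc] with s hs using e1 s hs

/-- From `s⁴ / 24 ≤ exp s - 1` for `s ≥ 0`. Keeping the `- 1` matters: the right side is then small
when the law concentrates near `0`. -/
lemma integral_pow_four_le {μ : Measure Ω} [IsProbabilityMeasure μ] {Y : Ω → ℝ} {c : ℝ}
    (hc : 0 < c) (hY : ∀ᵐ ω ∂μ, 0 ≤ Y ω) (h4 : Integrable (fun ω => Y ω ^ 4) μ)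
    (hint : Integrable (fun ω => Real.exp (c * Y ω)) μ) :
    ∫ ω, Y ω ^ 4 ∂μ ≤ 24 / c ^ 4 * (∫ ω, Real.exp (c * Y ω) ∂μ - 1) := by
  have h : ∫ ω, (Real.exp (c * Y ω) - 1) ∂μ = ∫ ω, Real.exp (c * Y ω) ∂μ - 1 := by
    rw [integral_sub hint (integrable_const _)]; simp
  rw [← h, ← integral_const_mul]
  refine integral_mono_ae h4 ((hint.sub (integrable_const _)).const_mul _) ?_
  filter_upwards [hY] with ω hω
  have hx : 0 ≤ c * Y ω := by positivity
  have h5 := Real.sum_le_exp_of_nonneg hx 5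
  simp only [Finset.sum_range_succ, Finset.range_zero, Finset.sum_empty, Nat.factorial] at h5
  norm_num at h5
  have h6 : (c * Y ω) ^ 4 ≤ 24 * (Real.exp (c * Y ω) - 1) := by
    nlinarith [pow_nonneg hx 2, pow_nonneg hx 3]
  rw [mul_pow] at h6
  rw [div_mul_eq_mul_div, le_div_iff₀ (by positivity)]
  linarith

variable {d γ : ℝ}

lemma hasDerivAt_sqrt_sub_two_mul {c t : ℝ} (ht : t < c ^ 2 / 2) :
    HasDerivAt (fun t => √(c ^ 2 - 2 * t)) (-(1 / √(c ^ 2 - 2 * t))) t := by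
  have h1 : HasDerivAt (fun t : ℝ => c ^ 2 - 2 * t) (-2) t := by
    simpa using ((hasDerivAt_id t).const_mul 2).const_sub (c ^ 2)
  refine (h1.sqrt (by linarith)).congr_deriv ?_
  rw [neg_div, neg_inj]
  have : 0 < √(c ^ 2 - 2 * t) := Real.sqrt_pos.2 (by linarith)
  field_simp

lemma integrable_exp_mul_igMeasure (hd : 0 < d) {t : ℝ} (ht : t < γ ^ 2 / 2) :
    Integrable (fun x => Real.exp (t * x)) (igMeasure d γ) := by
  simpa using integrable_exp_igMeasure hd (b := 0) (a := t) (by simpa using pow_pos hd 2)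
    (by linarith)

lemma integral_exp_mul_igMeasure (hd : 0 < d) {t : ℝ} (ht : t < γ ^ 2 / 2) :
    ∫ x, Real.exp (t * x) ∂(igMeasure d γ) = Real.exp (d * γ - d * √(γ ^ 2 - 2 * t)) := by
  have h := integral_exp_igMeasure hd (b := 0) (a := t) (by simpa using pow_pos hd 2)
    (by linarith)
  simpa [Real.sqrt_sq hd.le, hd.ne'] using h

lemma integrable_exp_mul_inv_igMeasure (hd : 0 < d) (hγ : 0 < γ) {t : ℝ} (ht : t < d ^ 2 / 2) :
    Integrable (fun x => Real.exp (t * x⁻¹)) (igMeasure d γ) := by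
  simpa [div_eq_mul_inv] using integrable_exp_igMeasure hd (b := t) (a := 0) (by linarith)
    (by simpa using pow_pos hγ 2)

lemma integral_exp_mul_inv_igMeasure (hd : 0 < d) (hγ : 0 < γ) {t : ℝ} (ht : t < d ^ 2 / 2) :
    ∫ x, Real.exp (t * x⁻¹) ∂(igMeasure d γ) =
      d / √(d ^ 2 - 2 * t) * Real.exp (d * γ - √(d ^ 2 - 2 * t) * γ) := by
  have h := integral_exp_igMeasure hd (b := t) (a := 0) (by linarith)
    (by simpa using pow_pos hγ 2)
  simpa [Real.sqrt_sq hγ.le, div_eq_mul_inv] using h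

lemma integral_id_igMeasure (hd : 0 < d) (hγ : 0 < γ) :
    ∫ x, x ∂(igMeasure d γ) = d / γ ∧
      ∫ x, x ^ 2 ∂(igMeasure d γ) = d ^ 2 / γ ^ 2 + d / γ ^ 3 := by
  have hr0 : √(γ ^ 2 - 2 * 0) = γ := by rw [mul_zero, sub_zero, Real.sqrt_sq hγ.le]
  have hE : ∀ t < γ ^ 2 / 2, HasDerivAt (fun t => Real.exp (d * γ - d * √(γ ^ 2 - 2 * t)))
      (Real.exp (d * γ - d * √(γ ^ 2 - 2 * t)) * (d / √(γ ^ 2 - 2 * t))) t := fun t ht =>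
    (((hasDerivAt_sqrt_sub_two_mul ht).const_mul d).const_sub (d * γ)).exp.congr_deriv (by ring)
  have h0 : (0 : ℝ) < γ ^ 2 / 2 := by positivity
  have h2 := (hE 0 h0).mul ((hasDerivAt_const (0 : ℝ) d).div (hasDerivAt_sqrt_sub_two_mul h0)
    (by rw [hr0]; exact hγ.ne'))
  have := integral_of_hasDerivAt_mgf h0 (fun t ht => integrable_exp_mul_igMeasure hd ht)
    (fun t ht => integral_exp_mul_igMeasure hd ht) hE h2
  simp only [hr0, sub_self, Real.exp_zero, one_mul] at this
  refine ⟨this.1, this.2.trans ?_⟩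
  simp only [hr0, Pi.div_apply]
  field_simp
  ring

lemma integral_inv_igMeasure (hd : 0 < d) (hγ : 0 < γ) :
    ∫ x, x⁻¹ ∂(igMeasure d γ) = 1 / d ^ 2 + γ / d ∧
      ∫ x, x⁻¹ ^ 2 ∂(igMeasure d γ) = 3 / d ^ 4 + 3 * γ / d ^ 3 + γ ^ 2 / d ^ 2 := by
  have hr0 : √(d ^ 2 - 2 * 0) = d := by rw [mul_zero, sub_zero, Real.sqrt_sq hd.le]
  have hE : ∀ t < d ^ 2 / 2, HasDerivAt (fun t => Real.exp (d * γ - √(d ^ 2 - 2 * t) * γ))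
      (Real.exp (d * γ - √(d ^ 2 - 2 * t) * γ) * (γ / √(d ^ 2 - 2 * t))) t := fun t ht =>
    (((hasDerivAt_sqrt_sub_two_mul ht).mul_const γ).const_sub (d * γ)).exp.congr_deriv (by ring)
  have hD : ∀ t < d ^ 2 / 2, HasDerivAt (fun t => d / √(d ^ 2 - 2 * t))
      (d / √(d ^ 2 - 2 * t) ^ 3) t := fun t ht => by
    have hr : 0 < √(d ^ 2 - 2 * t) := Real.sqrt_pos.2 (by linarith)
    refine ((hasDerivAt_const t d).div (hasDerivAt_sqrt_sub_two_mul ht) hr.ne').congr_deriv ?_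
    field_simp
    ring
  have hG : ∀ t < d ^ 2 / 2, HasDerivAt
      (fun t => d / √(d ^ 2 - 2 * t) ^ 3 + d * γ / √(d ^ 2 - 2 * t) ^ 2)
      (3 * d / √(d ^ 2 - 2 * t) ^ 5 + 2 * d * γ / √(d ^ 2 - 2 * t) ^ 4) t := fun t ht => by
    have hr : 0 < √(d ^ 2 - 2 * t) := Real.sqrt_pos.2 (by linarith)
    have h3 := hasDerivAt_sqrt_sub_two_mul ht
    refine (((hasDerivAt_const t d).div (h3.pow 3) (pow_pos hr 3).ne').add
      ((hasDerivAt_const t (d * γ)).div (h3.pow 2) (pow_pos hr 2).ne')).congr_deriv ?_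
    field_simp
    simp
    ring
  have h0 : (0 : ℝ) < d ^ 2 / 2 := by positivity
  have h1 : ∀ t < d ^ 2 / 2, HasDerivAt
      (fun t => d / √(d ^ 2 - 2 * t) * Real.exp (d * γ - √(d ^ 2 - 2 * t) * γ))
      ((d / √(d ^ 2 - 2 * t) ^ 3 + d * γ / √(d ^ 2 - 2 * t) ^ 2) *
        Real.exp (d * γ - √(d ^ 2 - 2 * t) * γ)) t := fun t ht => by
    have hr : 0 < √(d ^ 2 - 2 * t) := Real.sqrt_pos.2 (by linarith)
    refine ((hD t ht).mul (hE t ht)).congr_deriv ?_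
    field_simp
  have := integral_of_hasDerivAt_mgf h0 (fun t ht => integrable_exp_mul_inv_igMeasure hd hγ ht)
    (fun t ht => integral_exp_mul_inv_igMeasure hd hγ ht) h1 ((hG 0 h0).mul (hE 0 h0))
  simp only [hr0, sub_self, Real.exp_zero, one_mul, mul_one] at this
  refine ⟨this.1.trans (by field_simp), this.2.trans ?_⟩
  field_simp
  ring

lemma integrable_pow_igMeasure (hd : 0 < d) (hγ : 0 < γ) (n : ℕ) :
    Integrable (fun x => x ^ n) (igMeasure d γ) :=
  integrable_pow_of_exp (c := γ ^ 2 / 2) (by positivity)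
    (fun _ ht => integrable_exp_mul_igMeasure hd ht) n

lemma integrable_inv_pow_igMeasure (hd : 0 < d) (hγ : 0 < γ) (n : ℕ) :
    Integrable (fun x => x⁻¹ ^ n) (igMeasure d γ) :=
  integrable_pow_of_exp (c := d ^ 2 / 2) (by positivity)
    (fun _ ht => integrable_exp_mul_inv_igMeasure hd hγ ht) n

/-- The exponent of the generating function at `γ² / 4` is at most `dγ`, and `exp s - 1 ≤ 2 s` on
`(0, 1]`. The linear order in `d` is what the Lyapunov condition needs when `d = δ h`. -/
lemma integral_pow_four_igMeasure_le (hd : 0 < d) (hγ : 0 < γ) (h : d * γ ≤ 1) :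
    ∫ x, x ^ 4 ∂(igMeasure d γ) ≤ 24 * 4 ^ 4 / γ ^ 8 * (2 * (d * γ)) := by
  have := isProbabilityMeasure_igMeasure hd hγ
  have hc : γ ^ 2 / 4 < γ ^ 2 / 2 := by nlinarith [pow_pos hγ 2]
  refine (integral_pow_four_le (c := γ ^ 2 / 4) (by positivity)
    ((ae_pos_igMeasure d γ).mono fun _ => le_of_lt) (integrable_pow_igMeasure hd hγ 4)
    (integrable_exp_mul_igMeasure hd hc)).trans ?_
  rw [integral_exp_mul_igMeasure hd hc]
  have h1 : Real.exp (d * γ - d * √(γ ^ 2 - 2 * (γ ^ 2 / 4))) ≤ Real.exp (d * γ) :=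
    Real.exp_le_exp.2 (by have := Real.sqrt_nonneg (γ ^ 2 - 2 * (γ ^ 2 / 4)); nlinarith)
  have hp : 0 < d * γ := by positivity
  have h2 : Real.exp (d * γ) - 1 ≤ 2 * (d * γ) := by
    have := Real.abs_exp_sub_one_le (x := d * γ) (by rwa [abs_of_pos hp])
    rw [abs_of_pos hp] at this
    exact (le_abs_self _).trans this
  have e : 24 / (γ ^ 2 / 4) ^ 4 = 24 * 4 ^ 4 / γ ^ 8 := by field_simp
  rw [e]
  gcongr
  linarith

/-- With the scaling `d² / x` the generating function at `d² / 4` has prefactor at most `2` and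
exponent at most `1`, whence a bound free of the parameters. -/
lemma integral_inv_pow_four_igMeasure_le (hd : 0 < d) (hγ : 0 < γ) (h : d * γ ≤ 1) :
    ∫ x, (d ^ 2 * x⁻¹) ^ 4 ∂(igMeasure d γ) ≤ 24 * 4 ^ 4 * 8 := by
  have := isProbabilityMeasure_igMeasure hd hγ
  have hc : d ^ 2 / 4 < d ^ 2 / 2 := by nlinarith [pow_pos hd 2]
  have h1 := integral_pow_four_le (μ := igMeasure d γ) (Y := fun x => x⁻¹) (c := d ^ 2 / 4)
    (by positivity) ((ae_pos_igMeasure d γ).mono fun x hx => (inv_pos.2 hx).le)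
    (integrable_inv_pow_igMeasure hd hγ 4) (integrable_exp_mul_inv_igMeasure hd hγ hc)
  rw [integral_exp_mul_inv_igMeasure hd hγ hc] at h1
  simp_rw [mul_pow]
  rw [integral_const_mul]
  set r := √(d ^ 2 - 2 * (d ^ 2 / 4)) with hr
  have hr2 : d / 2 ≤ r := Real.le_sqrt_of_sq_le (by nlinarith [pow_pos hd 2])
  have hp : 0 < d * γ := by positivity
  have h2 : Real.exp (d * γ - r * γ) ≤ 3 := by
    have h3 : Real.exp (d * γ - r * γ) ≤ Real.exp 1 :=
      Real.exp_le_exp.2 (by nlinarith)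
    linarith [Real.exp_one_lt_d9]
  have h3 : d / r ≤ 2 := (div_le_iff₀ (by linarith)).2 (by linarith)
  have h4 : d / r * Real.exp (d * γ - r * γ) - 1 ≤ 8 := by
    have : d / r * Real.exp (d * γ - r * γ) ≤ 2 * 3 := by gcongr
    linarith
  calc (d ^ 2) ^ 4 * ∫ x, x⁻¹ ^ 4 ∂(igMeasure d γ)
      ≤ (d ^ 2) ^ 4 * (24 / (d ^ 2 / 4) ^ 4 * 8) := by
        gcongr
        refine h1.trans ?_
        gcongr
    _ = 24 * 4 ^ 4 * 8 := by field_simp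

end Moments

/-! ### A central limit theorem for triangular arrays -/

section CLT

/-- For `|x| ≤ 1` this is the exponential remainder; for `|x| ≥ 1` each of the four terms is
separately dominated by a multiple of `|x|³`. -/
lemma norm_exp_mul_I_sub_taylor_le (x : ℝ) :
    ‖Complex.exp (x * Complex.I) - 1 - x * Complex.I + x ^ 2 / 2‖ ≤ 5 * |x| ^ 3 := by
  have hn : ‖(x : ℂ) * Complex.I‖ = |x| := by simp
  rcases le_total |x| 1 with hx | hx
  · have h := Complex.exp_bound (x := x * Complex.I) (by rwa [hn]) (n := 3) (by norm_num)
    simp only [Finset.sum_range_succ, Finset.range_zero, Finset.sum_empty, hn, mul_pow,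
      Complex.I_sq, Nat.factorial] at h
    norm_num at h
    have e : Complex.exp (x * Complex.I) - 1 - x * Complex.I + x ^ 2 / 2 =
        Complex.exp (x * Complex.I) - (1 + x * Complex.I + -x ^ 2 / 2) := by ring
    rw [e]
    refine h.trans ?_
    nlinarith [pow_nonneg (abs_nonneg x) 3]
  · have h1 : ‖Complex.exp (x * Complex.I)‖ = 1 := Complex.norm_exp_ofReal_mul_I x
    have h2 : ‖(x : ℂ) ^ 2 / 2‖ = |x| ^ 2 / 2 := by simp
    calc _ ≤ ‖Complex.exp (x * Complex.I) - 1 - x * Complex.I‖ + ‖(x : ℂ) ^ 2 / 2‖ :=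
          norm_add_le _ _
      _ ≤ ‖Complex.exp (x * Complex.I)‖ + ‖(1 : ℂ)‖ + ‖(x : ℂ) * Complex.I‖ +
          ‖(x : ℂ) ^ 2 / 2‖ := by
          gcongr
          exact (norm_sub_le _ _).trans (by gcongr; exact norm_sub_le _ _)
      _ ≤ 5 * |x| ^ 3 := by
          rw [h1, h2, hn, norm_one]
          have h3 : |x| ≤ |x| ^ 3 := le_self_pow₀ hx (by norm_num)
          have h4 : |x| ^ 2 ≤ |x| ^ 3 := pow_le_pow_right₀ hx (by norm_num)
          linarith

variable {α : Type*} [MeasurableSpace α]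

/-- With `m = √n` this controls `n (φ - 1) + v / 2` for a centred variable. The third absolute
moment in the Taylor remainder is traded for the second and the fourth; the weight `a` is left free
to be sent to `0` later. -/
lemma norm_integral_exp_sub_le {μ : Measure α} [IsProbabilityMeasure μ] {Y : α → ℝ} {m a : ℝ}
    (hY : AEStronglyMeasurable Y μ) (h1 : Integrable Y μ) (h2 : Integrable (fun x => Y x ^ 2) μ)
    (h4 : Integrable (fun x => Y x ^ 4) μ) (h0 : ∫ x, Y x ∂μ = 0) (hm : 0 < m) (ha : 0 < a) :
    ‖(m : ℂ) ^ 2 * (∫ x, Complex.exp ((m⁻¹ * Y x : ℝ) * Complex.I) ∂μ - 1) +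
        ((∫ x, Y x ^ 2 ∂μ : ℝ) : ℂ) / 2‖ ≤
      5 / 2 * (a * ∫ x, Y x ^ 2 ∂μ + (∫ x, Y x ^ 4 ∂μ) / m ^ 2 / a) := by
  have i0 : Integrable (fun x => Complex.exp ((m⁻¹ * Y x : ℝ) * Complex.I)) μ := by
    refine .of_bound (by fun_prop) 1 (.of_forall fun x => ?_)
    rw [Complex.norm_exp_ofReal_mul_I]
  have i1 : Integrable (fun x => ((m⁻¹ * Y x : ℝ) : ℂ) * Complex.I) μ :=
    (h1.const_mul _).ofReal.mul_const _
  have i2 : Integrable (fun x => ((m⁻¹ * Y x : ℝ) : ℂ) ^ 2 / 2) μ := by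
    have := ((h2.const_mul (m⁻¹ ^ 2)).ofReal (𝕜 := ℂ)).div_const 2
    refine this.congr (.of_forall fun x => ?_)
    simp [mul_pow]
  have e : ∫ x, (Complex.exp ((m⁻¹ * Y x : ℝ) * Complex.I) - 1 - (m⁻¹ * Y x : ℝ) * Complex.I +
      ((m⁻¹ * Y x : ℝ) : ℂ) ^ 2 / 2) ∂μ =
      ∫ x, Complex.exp ((m⁻¹ * Y x : ℝ) * Complex.I) ∂μ - 1 +
        (m⁻¹ : ℂ) ^ 2 * ((∫ x, Y x ^ 2 ∂μ : ℝ) : ℂ) / 2 := by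
    have j0 : Integrable (fun x => Complex.exp ((m⁻¹ * Y x : ℝ) * Complex.I) - 1) μ :=
      i0.sub (integrable_const _)
    have j1 : Integrable (fun x => Complex.exp ((m⁻¹ * Y x : ℝ) * Complex.I) - 1 -
      (m⁻¹ * Y x : ℝ) * Complex.I) μ := j0.sub i1
    rw [integral_add j1 i2, integral_sub j0 i1, integral_sub i0 (integrable_const _)]
    have e1 : ∫ x, ((m⁻¹ * Y x : ℝ) : ℂ) * Complex.I ∂μ = 0 := by
      rw [integral_mul_const, integral_complex_ofReal, integral_const_mul, h0]; simp
    have e2 : ∫ x, ((m⁻¹ * Y x : ℝ) : ℂ) ^ 2 / 2 ∂μ =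
        (m⁻¹ : ℂ) ^ 2 * ((∫ x, Y x ^ 2 ∂μ : ℝ) : ℂ) / 2 := by
      rw [← integral_complex_ofReal, ← integral_const_mul, ← integral_div]
      simp [mul_pow]
    rw [e1, e2]
    simp
  have hmc : (m : ℂ) ≠ 0 := by exact_mod_cast hm.ne'
  have e' : (m : ℂ) ^ 2 * (∫ x, Complex.exp ((m⁻¹ * Y x : ℝ) * Complex.I) ∂μ - 1) +
      ((∫ x, Y x ^ 2 ∂μ : ℝ) : ℂ) / 2 = (m : ℂ) ^ 2 *
      ∫ x, (Complex.exp ((m⁻¹ * Y x : ℝ) * Complex.I) - 1 - (m⁻¹ * Y x : ℝ) * Complex.I +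
      ((m⁻¹ * Y x : ℝ) : ℂ) ^ 2 / 2) ∂μ := by
    rw [e, mul_add, add_right_inj, ← mul_div_assoc, ← mul_assoc, ← mul_pow, mul_inv_cancel₀ hmc,
      one_pow, one_mul]
  rw [e', norm_mul, norm_pow, Complex.norm_real, Real.norm_of_nonneg hm.le]
  have hb : ‖∫ x, (Complex.exp ((m⁻¹ * Y x : ℝ) * Complex.I) - 1 -
      (m⁻¹ * Y x : ℝ) * Complex.I + ((m⁻¹ * Y x : ℝ) : ℂ) ^ 2 / 2) ∂μ‖ ≤
      ∫ x, 5 / 2 * (a * Y x ^ 2 + Y x ^ 4 / m ^ 2 / a) / m ^ 2 ∂μ := by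
    refine norm_integral_le_of_norm_le ?_ (.of_forall fun x => ?_)
    · exact (((h2.const_mul a).add ((h4.div_const _).div_const _)).const_mul _).div_const _
    · refine (norm_exp_mul_I_sub_taylor_le _).trans ?_
      rw [abs_mul, mul_pow, abs_of_pos (inv_pos.2 hm)]
      have h5 : 2 * |Y x| ^ 3 / m ≤ a * Y x ^ 2 + Y x ^ 4 / m ^ 2 / a := by
        -- The weighted arithmetic–geometric inequality, as an expanded square.
        have h6 : 0 ≤ a * (|Y x| - |Y x| ^ 2 / (m * a)) ^ 2 := by positivity
        have h7 : a * (|Y x| - |Y x| ^ 2 / (m * a)) ^ 2 =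
            a * |Y x| ^ 2 + |Y x| ^ 4 / m ^ 2 / a - 2 * |Y x| ^ 3 / m := by
          field_simp
          ring
        rw [h7, sq_abs, Even.pow_abs (by decide)] at h6
        linarith
      calc 5 * (m⁻¹ ^ 3 * |Y x| ^ 3) = 5 / 2 * (2 * |Y x| ^ 3 / m) / m ^ 2 := by
            field_simp
        _ ≤ _ := by gcongr
  calc m ^ 2 * _ ≤ m ^ 2 * ∫ x, 5 / 2 * (a * Y x ^ 2 + Y x ^ 4 / m ^ 2 / a) / m ^ 2 ∂μ := by
        gcongr
    _ = _ := by
        rw [integral_div, integral_const_mul,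
          integral_add (h2.const_mul a) ((h4.div_const _).div_const _),
          integral_const_mul, integral_div, integral_div]
        field_simp

/-- Lyapunov's theorem for rows of i.i.d. variables: `n (φ_n - 1) → -v/2` implies `φ_n ^ n → exp
(-v/2)`. -/
lemma tendsto_integral_exp_pow {μ : ℕ → Measure α} (hμ : ∀ n, IsProbabilityMeasure (μ n))
    {Y : ℕ → α → ℝ} {v : ℝ} (h1 : ∀ n, Integrable (Y n) (μ n))
    (h2 : ∀ n, Integrable (fun x => Y n x ^ 2) (μ n))
    (h4 : ∀ n, Integrable (fun x => Y n x ^ 4) (μ n)) (h0 : ∀ n, ∫ x, Y n x ∂(μ n) = 0)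
    (hv : Tendsto (fun n => ∫ x, Y n x ^ 2 ∂(μ n)) atTop (𝓝 v))
    (h4' : Tendsto (fun n : ℕ => (∫ x, Y n x ^ 4 ∂(μ n)) / n) atTop (𝓝 0)) :
    Tendsto (fun n : ℕ => (∫ x, Complex.exp (((√n)⁻¹ * Y n x : ℝ) * Complex.I) ∂(μ n)) ^ n)
      atTop (𝓝 (Complex.exp (-(v : ℂ) / 2))) := by
  have hsub : ∀ n : ℕ, ∫ x, Complex.exp (((√n)⁻¹ * Y n x : ℝ) * Complex.I) ∂(μ n) =
      1 + (∫ x, Complex.exp (((√n)⁻¹ * Y n x : ℝ) * Complex.I) ∂(μ n) - 1) := fun n => by ring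
  simp_rw +singlePass [hsub]
  apply Complex.tendsto_one_add_pow_exp_of_tendsto
  have hlim : Tendsto (fun n => -((∫ x, Y n x ^ 2 ∂(μ n) : ℝ) : ℂ) / 2) atTop
      (𝓝 (-(v : ℂ) / 2)) :=
    (((Complex.continuous_ofReal.tendsto v).comp hv).neg).div_const 2
  refine hlim.congr_dist ?_
  let q : ℕ → ℝ := fun n => (∫ x, Y n x ^ 4 ∂(μ n)) / n
  have hq : ∀ n, 0 ≤ q n := fun n => div_nonneg (integral_nonneg fun _ => by positivity)
    (by positivity)
  -- The weight tends to `0` and satisfies `q n / a n ≤ a n`; the summand `1 / (n + 1)` keeps it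
  -- positive when `q n = 0`.
  let a : ℕ → ℝ := fun n => √(q n + 1 / ((n : ℝ) + 1))
  have ha : ∀ n, 0 < a n := fun n => Real.sqrt_pos.2 (add_pos_of_nonneg_of_pos (hq n)
    (by positivity))
  have ha0 : Tendsto a atTop (𝓝 0) := by
    have h := (h4'.add (tendsto_one_div_add_atTop_nhds_zero_nat (𝕜 := ℝ)))
    rw [add_zero] at h
    have h' := (Real.continuous_sqrt.tendsto 0).comp h
    rwa [Real.sqrt_zero] at h'
  have hb : Tendsto (fun n => 5 / 2 * (a n * ∫ x, Y n x ^ 2 ∂(μ n) + a n)) atTop (𝓝 0) := by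
    simpa using ((ha0.mul hv).add ha0).const_mul (5 / 2)
  refine squeeze_zero' (.of_forall fun _ => dist_nonneg) ?_ hb
  filter_upwards [eventually_gt_atTop 0] with n hn
  have hn' : (0 : ℝ) < n := by exact_mod_cast hn
  have hs : (√(n : ℝ)) ^ 2 = n := Real.sq_sqrt hn'.le
  have h := norm_integral_exp_sub_le (h1 n).aestronglyMeasurable (h1 n) (h2 n) (h4 n) (h0 n)
    (Real.sqrt_pos.2 hn') (ha n)
  rw [dist_comm, dist_eq_norm, neg_div, sub_neg_eq_add]
  have hsc : ((√(n : ℝ) : ℝ) : ℂ) ^ 2 = n := by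
    rw [← Complex.ofReal_pow, hs]; simp
  rw [hsc, hs] at h
  refine h.trans ?_
  gcongr
  rw [div_le_iff₀ (ha n), ← sq, Real.sq_sqrt (add_nonneg (hq n) (by positivity))]
  have : 0 ≤ 1 / ((n : ℝ) + 1) := by positivity
  change q n ≤ _
  linarith

end CLT

/-! ### The central limit theorem for the inverse-Gaussian score -/

section IGScore

/-- The normalised score of one observation from `IG(d, γ)`. -/
noncomputable def igScore (d γ x : ℝ) : EuclideanSpace ℝ (Fin 2) :=
  !₂[(1 + γ * d - d ^ 2 * x⁻¹) / √2, √(γ / d) * (d - γ * x)]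

lemma measurable_igScore (d γ : ℝ) : Measurable (igScore d γ) := by
  unfold igScore
  refine (WithLp.measurable_toLp 2 _).comp (measurable_pi_iff.2 fun i => ?_)
  fin_cases i
  · simp; fun_prop
  · simp; fun_prop

lemma inner_igScore (d γ x : ℝ) (t : EuclideanSpace ℝ (Fin 2)) :
    inner ℝ (igScore d γ x) t =
      t 0 / √2 * (1 + γ * d - d ^ 2 * x⁻¹) + t 1 * √(γ / d) * (d - γ * x) := by
  simp [igScore, PiLp.inner_apply, Fin.sum_univ_two]
  ring

lemma euclidean_norm_sq_two (t : EuclideanSpace ℝ (Fin 2)) : ‖t‖ ^ 2 = t 0 ^ 2 + t 1 ^ 2 := by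
  rw [EuclideanSpace.real_norm_sq_eq, Fin.sum_univ_two]

variable {d γ : ℝ}

lemma integrable_id_igMeasure (hd : 0 < d) (hγ : 0 < γ) :
    Integrable (fun x => x) (igMeasure d γ) := by
  simpa using integrable_pow_igMeasure hd hγ 1

lemma integrable_inv_igMeasure (hd : 0 < d) (hγ : 0 < γ) :
    Integrable (fun x => x⁻¹) (igMeasure d γ) := by
  simpa using integrable_inv_pow_igMeasure hd hγ 1

lemma integral_lin_igMeasure (hd : 0 < d) (hγ : 0 < γ) (a b : ℝ) :
    Integrable (fun x => a * (1 + γ * d - d ^ 2 * x⁻¹) + b * (d - γ * x)) (igMeasure d γ) ∧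
    ∫ x, (a * (1 + γ * d - d ^ 2 * x⁻¹) + b * (d - γ * x)) ∂(igMeasure d γ) = 0 := by
  have := isProbabilityMeasure_igMeasure hd hγ
  have i1 := (integrable_id_igMeasure hd hγ).const_mul γ
  have i2 := (integrable_inv_igMeasure hd hγ).const_mul (d ^ 2)
  have j1 : Integrable (fun x => a * (1 + γ * d - d ^ 2 * x⁻¹)) (igMeasure d γ) :=
    ((integrable_const (1 + γ * d)).sub i2).const_mul a
  have j2 : Integrable (fun x => b * (d - γ * x)) (igMeasure d γ) :=
    ((integrable_const d).sub i1).const_mul b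
  refine ⟨j1.add j2, ?_⟩
  rw [integral_add j1 j2, integral_const_mul, integral_const_mul,
    integral_sub (integrable_const _) i2, integral_sub (integrable_const _) i1,
    integral_const_mul, integral_const_mul, (integral_id_igMeasure hd hγ).1,
    (integral_inv_igMeasure hd hγ).1]
  simp
  field_simp
  ring

lemma integral_lin_sq_igMeasure (hd : 0 < d) (hγ : 0 < γ) (a b : ℝ) :
    Integrable (fun x => (a * (1 + γ * d - d ^ 2 * x⁻¹) + b * (d - γ * x)) ^ 2)
      (igMeasure d γ) ∧
    ∫ x, (a * (1 + γ * d - d ^ 2 * x⁻¹) + b * (d - γ * x)) ^ 2 ∂(igMeasure d γ) =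
      a ^ 2 * (2 + γ * d) + b ^ 2 * (d / γ) - 2 * a * b * d := by
  have := isProbabilityMeasure_igMeasure hd hγ
  have i1 := integrable_id_igMeasure hd hγ
  have i2 := integrable_inv_igMeasure hd hγ
  have i3 := integrable_pow_igMeasure hd hγ 2
  have i4 := integrable_inv_pow_igMeasure hd hγ 2
  set c := a * (1 + γ * d) + b * d with hc
  -- The mixed term is constant because `x⁻¹ x = 1`, true only for `x ≠ 0`; hence an
  -- almost-everywhere identity, and no mixed moment to compute.
  have e : (fun x => (a * (1 + γ * d - d ^ 2 * x⁻¹) + b * (d - γ * x)) ^ 2) =ᵐ[igMeasure d γ]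
      fun x => (c ^ 2 + 2 * a * b * d ^ 2 * γ) + (-(2 * c * a * d ^ 2)) * x⁻¹ +
        (-(2 * c * b * γ)) * x + (a * d ^ 2) ^ 2 * x⁻¹ ^ 2 + (b * γ) ^ 2 * x ^ 2 := by
    filter_upwards [ae_pos_igMeasure d γ] with x hx
    rw [hc]
    field_simp
    ring
  have j2 := (integrable_const (μ := igMeasure d γ) (c ^ 2 + 2 * a * b * d ^ 2 * γ)).fun_add
    (i2.const_mul (-(2 * c * a * d ^ 2)))
  have j3 := j2.fun_add (i1.const_mul (-(2 * c * b * γ)))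
  have j4 := j3.fun_add (i4.const_mul ((a * d ^ 2) ^ 2))
  have j5 := j4.fun_add (i3.const_mul ((b * γ) ^ 2))
  refine ⟨j5.congr e.symm, ?_⟩
  rw [integral_congr_ae e, integral_add j4 (i3.const_mul _), integral_add j3 (i4.const_mul _),
    integral_add j2 (i1.const_mul _), integral_add (integrable_const _) (i2.const_mul _)]
  rw [integral_const_mul, integral_const_mul, integral_const_mul, integral_const_mul,
    (integral_id_igMeasure hd hγ).1, (integral_id_igMeasure hd hγ).2,
    (integral_inv_igMeasure hd hγ).1, (integral_inv_igMeasure hd hγ).2, integral_const,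
    probReal_univ, one_smul]
  rw [hc]
  field_simp
  ring

lemma add_pow_four_le (x y : ℝ) : (x + y) ^ 4 ≤ 8 * (x ^ 4 + y ^ 4) := by
  have h1 : (x + y) ^ 2 ≤ 2 * (x ^ 2 + y ^ 2) := by nlinarith [sq_nonneg (x - y)]
  have h2 : (x ^ 2 + y ^ 2) ^ 2 ≤ 2 * (x ^ 4 + y ^ 4) := by
    nlinarith [sq_nonneg (x ^ 2 - y ^ 2)]
  calc (x + y) ^ 4 = ((x + y) ^ 2) ^ 2 := by ring
    _ ≤ (2 * (x ^ 2 + y ^ 2)) ^ 2 := by gcongr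
    _ ≤ _ := by nlinarith

/-- The constant dominates the coefficients `3146752`, `64` and `786432` found at the end. For `b =
t √(γ/d)` the last term becomes `t⁴ / (dγ)`; divided by `n` it is of order `1 / T`. -/
lemma integral_lin_pow_four_igMeasure_le (hd : 0 < d) (hγ : 0 < γ) (a b : ℝ) :
    Integrable (fun x => (a * (1 + γ * d - d ^ 2 * x⁻¹) + b * (d - γ * x)) ^ 4)
      (igMeasure d γ) ∧
    (d * γ ≤ 1 → ∫ x, (a * (1 + γ * d - d ^ 2 * x⁻¹) + b * (d - γ * x)) ^ 4 ∂(igMeasure d γ) ≤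
      4000000 * (a ^ 4 + (b * (d * γ)) ^ 4 / γ ^ 4 + b ^ 4 * (d * γ) / γ ^ 4)) := by
  have := isProbabilityMeasure_igMeasure hd hγ
  have i3 := integrable_pow_igMeasure hd hγ 4
  have i4 : Integrable (fun x => (d ^ 2 * x⁻¹) ^ 4) (igMeasure d γ) := by
    simpa only [mul_pow] using (integrable_inv_pow_igMeasure hd hγ 4).const_mul ((d ^ 2) ^ 4)
  have hb : ∀ x, (a * (1 + γ * d - d ^ 2 * x⁻¹) + b * (d - γ * x)) ^ 4 ≤
      (64 * a ^ 4 * (1 + γ * d) ^ 4 + 64 * b ^ 4 * d ^ 4) + 64 * a ^ 4 * (d ^ 2 * x⁻¹) ^ 4 +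
        64 * b ^ 4 * γ ^ 4 * x ^ 4 := fun x => by
    have h1 := add_pow_four_le (a * (1 + γ * d - d ^ 2 * x⁻¹)) (b * (d - γ * x))
    have h2 := add_pow_four_le (1 + γ * d) (-(d ^ 2 * x⁻¹))
    have h3 := add_pow_four_le d (-(γ * x))
    rw [← sub_eq_add_neg, Even.neg_pow (by decide)] at h2 h3
    have h4 : (a * (1 + γ * d - d ^ 2 * x⁻¹)) ^ 4 ≤
        a ^ 4 * (8 * ((1 + γ * d) ^ 4 + (d ^ 2 * x⁻¹) ^ 4)) := by
      rw [mul_pow]; gcongr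
    have h5 : (b * (d - γ * x)) ^ 4 ≤ b ^ 4 * (8 * (d ^ 4 + (γ * x) ^ 4)) := by
      rw [mul_pow]; gcongr
    rw [mul_pow γ x] at h5
    linarith
  have j1 := (integrable_const (μ := igMeasure d γ)
    (64 * a ^ 4 * (1 + γ * d) ^ 4 + 64 * b ^ 4 * d ^ 4)).fun_add (i4.const_mul (64 * a ^ 4))
  have j2 := j1.fun_add (i3.const_mul (64 * b ^ 4 * γ ^ 4))
  have i : Integrable (fun x => (a * (1 + γ * d - d ^ 2 * x⁻¹) + b * (d - γ * x)) ^ 4)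
      (igMeasure d γ) := by
    refine j2.mono' (Measurable.aestronglyMeasurable (by fun_prop)) (.of_forall fun x => ?_)
    rw [Real.norm_of_nonneg (by positivity)]
    exact hb x
  refine ⟨i, fun h => ?_⟩
  refine (integral_mono i j2 hb).trans ?_
  rw [integral_add j1 (i3.const_mul _), integral_add (integrable_const _) (i4.const_mul _),
    integral_const_mul, integral_const_mul, integral_const, probReal_univ, one_smul]
  have h1 := integral_pow_four_igMeasure_le hd hγ h
  have h2 := integral_inv_pow_four_igMeasure_le hd hγ h
  have hp : 0 < d * γ := by positivity
  have h3 : (1 + γ * d) ^ 4 ≤ 16 := by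
    calc (1 + γ * d) ^ 4 ≤ (1 + 1) ^ 4 := by gcongr; linarith
      _ = 16 := by norm_num
  calc _ ≤ 64 * a ^ 4 * 16 + 64 * b ^ 4 * d ^ 4 + 64 * a ^ 4 * (24 * 4 ^ 4 * 8) +
        64 * b ^ 4 * γ ^ 4 * (24 * 4 ^ 4 / γ ^ 8 * (2 * (d * γ))) := by gcongr
    _ = 3146752 * a ^ 4 + 64 * ((b * (d * γ)) ^ 4 / γ ^ 4) +
        786432 * (b ^ 4 * (d * γ) / γ ^ 4) := by
        field_simp
        ring
    _ ≤ _ := by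
        have p1 : 0 ≤ a ^ 4 := by positivity
        have p2 : 0 ≤ (b * (d * γ)) ^ 4 / γ ^ 4 := by positivity
        have p3 : 0 ≤ b ^ 4 * (d * γ) / γ ^ 4 := by positivity
        linarith

/-- Central limit theorem for the normalised score of inverse-Gaussian observations. -/
lemma tendsto_charFun_igScore {Ω : Type*} [MeasurableSpace Ω] {P : ℕ → Measure Ω}
    {d γ : ℕ → ℝ} (hd : ∀ n, 0 < d n) (hγ : ∀ n, 0 < γ n)
    (hdγ : Tendsto (fun n => d n * γ n) atTop (𝓝 0))
    (hn : Tendsto (fun n => n * (d n * γ n)) atTop atTop) {Y : ℕ → ℕ → Ω → ℝ}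
    (hY : ∀ n j, Measurable (Y n j)) (hind : ∀ n, iIndepFun (Y n) (P n))
    (hlaw : ∀ n j, (P n).map (Y n j) = igMeasure (d n) (γ n)) (t : EuclideanSpace ℝ (Fin 2)) :
    Tendsto (fun n : ℕ => charFun ((P n).map fun ω =>
      (√(n : ℝ))⁻¹ • ∑ j ∈ Finset.range n, igScore (d n) (γ n) (Y n j ω)) t) atTop
      (𝓝 (charFun (stdGaussian (EuclideanSpace ℝ (Fin 2))) t)) := by
  have hμ : ∀ n, IsProbabilityMeasure (igMeasure (d n) (γ n)) := fun n =>
    isProbabilityMeasure_igMeasure (hd n) (hγ n)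
  -- Independence and equality of laws within a row turn the characteristic function of the sum into
  -- an `n`-th power.
  have key : ∀ n : ℕ, charFun ((P n).map fun ω =>
      (√(n : ℝ))⁻¹ • ∑ j ∈ Finset.range n, igScore (d n) (γ n) (Y n j ω)) t =
      (∫ x, Complex.exp (((√n)⁻¹ * (t 0 / √2 * (1 + γ n * d n - d n ^ 2 * x⁻¹) +
        t 1 * √(γ n / d n) * (d n - γ n * x)) : ℝ) * Complex.I)
        ∂(igMeasure (d n) (γ n))) ^ n := by
    intro n
    have hm : ∀ j, Measurable fun ω => igScore (d n) (γ n) (Y n j ω) := fun j =>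
      (measurable_igScore _ _).comp (hY n j)
    have hS : AEMeasurable (fun ω => ∑ j ∈ Finset.range n, igScore (d n) (γ n) (Y n j ω)) (P n) :=
      (Finset.measurable_fun_sum _ fun j _ => hm j).aemeasurable
    have e1 : (fun ω => (√(n : ℝ))⁻¹ • ∑ j ∈ Finset.range n, igScore (d n) (γ n) (Y n j ω)) =
        (fun z => (√(n : ℝ))⁻¹ • z) ∘
          fun ω => ∑ j ∈ Finset.range n, igScore (d n) (γ n) (Y n j ω) := rfl
    have hind' := (hind n).comp (fun _ => igScore (d n) (γ n)) fun _ => measurable_igScore _ _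
    rw [e1, ← AEMeasurable.map_map_of_aemeasurable (by fun_prop) hS, charFun_map_smul,
      iIndepFun.charFun_map_fun_finsetSum_eq_prod
        (X := fun j ω => igScore (d n) (γ n) (Y n j ω)) (fun j _ => (hm j).aemeasurable)
        (hind'.restrict _), Finset.prod_apply]
    rw [Finset.prod_congr rfl (g := fun _ => ∫ x, Complex.exp (((√n)⁻¹ * (t 0 / √2 *
      (1 + γ n * d n - d n ^ 2 * x⁻¹) + t 1 * √(γ n / d n) * (d n - γ n * x)) : ℝ) * Complex.I)
        ∂(igMeasure (d n) (γ n))), Finset.prod_const, Finset.card_range]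
    intro j _
    have e2 : (P n).map (fun ω => igScore (d n) (γ n) (Y n j ω)) =
        (igMeasure (d n) (γ n)).map (igScore (d n) (γ n)) := by
      rw [← hlaw n j, Measure.map_map (measurable_igScore _ _) (hY n j)]
      rfl
    rw [e2, charFun_apply, integral_map (measurable_igScore _ _).aemeasurable
      (Measurable.aestronglyMeasurable (by fun_prop))]
    simp_rw [inner_smul_right, inner_igScore]
  simp_rw [key]
  have hsq : ∀ n, √(γ n / d n) ^ 2 = γ n / d n := fun n =>
    Real.sq_sqrt (div_pos (hγ n) (hd n)).le
  have hlim : charFun (stdGaussian (EuclideanSpace ℝ (Fin 2))) t =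
      Complex.exp (-((t 0 ^ 2 + t 1 ^ 2 : ℝ) : ℂ) / 2) := by
    rw [charFun_stdGaussian, ← euclidean_norm_sq_two]
    push_cast
    rfl
  rw [hlim]
  refine tendsto_integral_exp_pow hμ
    (fun n => (integral_lin_igMeasure (hd n) (hγ n) _ _).1)
    (fun n => (integral_lin_sq_igMeasure (hd n) (hγ n) _ _).1)
    (fun n => (integral_lin_pow_four_igMeasure_le (hd n) (hγ n) _ _).1)
    (fun n => (integral_lin_igMeasure (hd n) (hγ n) _ _).2) ?_ ?_
  · simp_rw [fun n => (integral_lin_sq_igMeasure (hd n) (hγ n)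
      (t 0 / √2) (t 1 * √(γ n / d n))).2]
    -- The covariance of the two coordinates is of order `√(dγ)`: they decorrelate as `dγ → 0`, so
    -- the limit is the standard Gaussian law.
    have e : ∀ n, (t 0 / √2) ^ 2 * (2 + γ n * d n) + (t 1 * √(γ n / d n)) ^ 2 * (d n / γ n) -
        2 * (t 0 / √2) * (t 1 * √(γ n / d n)) * d n =
        t 0 ^ 2 * (1 + d n * γ n / 2) + t 1 ^ 2 - 2 * (t 0 / √2) * t 1 * √(d n * γ n) := by
      intro n
      have h1 := (hd n).ne'
      have h2 := (hγ n).ne'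
      have e1 : √(γ n / d n) * d n = √(d n * γ n) := by
        have e2 : d n * γ n = γ n / d n * d n ^ 2 := by field_simp
        rw [e2, Real.sqrt_mul (div_pos (hγ n) (hd n)).le, Real.sqrt_sq (hd n).le]
      rw [← e1, mul_pow, hsq, div_pow, Real.sq_sqrt (by norm_num)]
      field_simp
    simp_rw [e]
    have h0 : Tendsto (fun n => √(d n * γ n)) atTop (𝓝 0) := by
      simpa using! (Real.continuous_sqrt.tendsto 0).comp hdγ
    simpa using ((((hdγ.div_const 2).const_add 1).const_mul (t 0 ^ 2)).add_const
      (t 1 ^ 2)).sub (h0.const_mul (2 * (t 0 / √2) * t 1))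
  · have hbd : Tendsto (fun n : ℕ => 4000000 * ((t 0 / √2) ^ 4 * (1 / (n : ℝ)) +
        t 1 ^ 4 * (d n * γ n) ^ 2 * (1 / (n : ℝ)) + t 1 ^ 4 * (n * (d n * γ n))⁻¹))
        atTop (𝓝 0) := by
      have h1 := tendsto_one_div_atTop_nhds_zero_nat (𝕜 := ℝ)
      simpa using (((h1.const_mul ((t 0 / √2) ^ 4)).add (((hdγ.pow 2).const_mul (t 1 ^ 4)).mul
        h1)).add (hn.inv_tendsto_atTop.const_mul (t 1 ^ 4))).const_mul 4000000
    refine squeeze_zero' (.of_forall fun n => div_nonneg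
      (integral_nonneg fun _ => by positivity) (by positivity)) ?_ hbd
    filter_upwards [hdγ.eventually (Iio_mem_nhds one_pos), eventually_gt_atTop 0] with n h1 hn0
    have hn' : (0 : ℝ) < n := by exact_mod_cast hn0
    have h := (integral_lin_pow_four_igMeasure_le (hd n) (hγ n) (t 0 / √2)
      (t 1 * √(γ n / d n))).2 (le_of_lt h1)
    have hs4 : √(γ n / d n) ^ 4 = (γ n / d n) ^ 2 := by
      rw [show 4 = 2 * 2 by norm_num, pow_mul, hsq]
    rw [div_le_iff₀ hn']
    refine h.trans (le_of_eq ?_)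
    have h2 := (hd n).ne'
    have h3 := (hγ n).ne'
    simp only [mul_pow (t 1), mul_pow (t 1 * √(γ n / d n)), hs4]
    field_simp

end IGScore

/-! ### The log-likelihood, its derivatives, and its maximizer -/

section LogLik

/-- The function `n log δ + δ γ T - (δ² A + γ² B) / 2` of `(δ, γ)`. -/
noncomputable def quadLogLik (n T A B : ℝ) (θ : EuclideanSpace ℝ (Fin 2)) : ℝ :=
  n * Real.log (θ 0) + θ 0 * θ 1 * T - 1 / 2 * (θ 0 ^ 2 * A + θ 1 ^ 2 * B)

lemma hasFDerivAt_coord (i : Fin 2) (θ : EuclideanSpace ℝ (Fin 2)) :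
    HasFDerivAt (fun θ : EuclideanSpace ℝ (Fin 2) => θ i)
      (EuclideanSpace.proj (𝕜 := ℝ) i) θ :=
  (EuclideanSpace.proj (𝕜 := ℝ) i).hasFDerivAt

lemma eventually_coord_ne {θ : EuclideanSpace ℝ (Fin 2)} (h : θ 0 ≠ 0) :
    ∀ᶠ ρ in 𝓝 θ, ρ 0 ≠ 0 :=
  (hasFDerivAt_coord 0 θ).continuousAt.eventually_ne h

variable (n T A B : ℝ) {θ : EuclideanSpace ℝ (Fin 2)}

lemma hasFDerivAt_quadLogLik (h : θ 0 ≠ 0) :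
    HasFDerivAt (quadLogLik n T A B)
      ((n / θ 0 + θ 1 * T - θ 0 * A) • EuclideanSpace.proj (𝕜 := ℝ) 0 +
        (θ 0 * T - θ 1 * B) • EuclideanSpace.proj (𝕜 := ℝ) 1) θ := by
  have h0 := hasFDerivAt_coord 0 θ
  have h1 := hasFDerivAt_coord 1 θ
  have := (((h0.log h).const_mul n).add ((h0.mul h1).mul_const T)).sub
    ((((h0.pow 2).mul_const A).add ((h1.pow 2).mul_const B)).const_mul (1 / 2))
  refine this.congr_fderiv ?_
  ext v
  simp
  ring

lemma partialDeriv_zero_quadLogLik (h : θ 0 ≠ 0) :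
    partialDeriv 0 (quadLogLik n T A B) θ = n / θ 0 + θ 1 * T - θ 0 * A := by
  rw [partialDeriv, (hasFDerivAt_quadLogLik n T A B h).fderiv]
  simp

lemma partialDeriv_one_quadLogLik (h : θ 0 ≠ 0) :
    partialDeriv 1 (quadLogLik n T A B) θ = θ 0 * T - θ 1 * B := by
  rw [partialDeriv, (hasFDerivAt_quadLogLik n T A B h).fderiv]
  simp

lemma scoreFun_quadLogLik (h : θ 0 ≠ 0) :
    scoreFun (quadLogLik n T A B) θ =
      !₂[n / θ 0 + θ 1 * T - θ 0 * A, θ 0 * T - θ 1 * B] := by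
  ext k
  fin_cases k
  · simpa [scoreFun] using partialDeriv_zero_quadLogLik n T A B h
  · simpa [scoreFun] using partialDeriv_one_quadLogLik n T A B h

lemma observedInfo_quadLogLik (h : θ 0 ≠ 0) :
    observedInfo (quadLogLik n T A B) θ = !![n / θ 0 ^ 2 + A, -T; -T, B] := by
  have h0 := hasFDerivAt_coord 0 θ
  have h1 := hasFDerivAt_coord 1 θ
  have d0 : fderiv ℝ (partialDeriv 0 (quadLogLik n T A B)) θ =
      (-(n / θ 0 ^ 2 + A)) • EuclideanSpace.proj (𝕜 := ℝ) 0 +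
        T • EuclideanSpace.proj (𝕜 := ℝ) 1 := by
    have e : partialDeriv 0 (quadLogLik n T A B) =ᶠ[𝓝 θ]
        fun ρ => n / ρ 0 + ρ 1 * T - ρ 0 * A := by
      filter_upwards [eventually_coord_ne h] with ρ hρ
      exact partialDeriv_zero_quadLogLik n T A B hρ
    have hd : HasFDerivAt (fun ρ : EuclideanSpace ℝ (Fin 2) => n / ρ 0)
        ((-(n / θ 0 ^ 2)) • EuclideanSpace.proj (𝕜 := ℝ) 0) θ := by
      have := ((hasDerivAt_inv h).comp_hasFDerivAt θ h0).const_mul n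
      refine (this.congr_fderiv ?_).congr_of_eventuallyEq (.of_forall fun ρ => by
        simp [div_eq_mul_inv])
      ext v
      simp
      ring
    refine e.fderiv_eq.trans (((hd.add (h1.mul_const T)).sub (h0.mul_const A)).fderiv.trans ?_)
    ext v
    simp
    ring
  have d1 : fderiv ℝ (partialDeriv 1 (quadLogLik n T A B)) θ =
      T • EuclideanSpace.proj (𝕜 := ℝ) 0 + (-B) • EuclideanSpace.proj (𝕜 := ℝ) 1 := by
    have e : partialDeriv 1 (quadLogLik n T A B) =ᶠ[𝓝 θ] fun ρ => ρ 0 * T - ρ 1 * B := by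
      filter_upwards [eventually_coord_ne h] with ρ hρ
      exact partialDeriv_one_quadLogLik n T A B hρ
    refine e.fderiv_eq.trans (((h0.mul_const T).sub (h1.mul_const B)).fderiv.trans ?_)
    ext v
    simp
    ring
  ext i j
  simp only [observedInfo, Matrix.of_apply]
  rw [partialDeriv]
  fin_cases i <;> fin_cases j <;> simp [d0, d1]

lemma contDiffOn_quadLogLik {Θ : Set (EuclideanSpace ℝ (Fin 2))} (h : ∀ θ ∈ Θ, θ 0 ≠ 0) :
    ContDiffOn ℝ 2 (quadLogLik n T A B) Θ := by
  have hc : ∀ i : Fin 2, ContDiffOn ℝ 2 (fun θ : EuclideanSpace ℝ (Fin 2) => θ i) Θ := fun i =>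
    (EuclideanSpace.proj (𝕜 := ℝ) i).contDiff.contDiffOn
  exact ((contDiffOn_const.mul ((hc 0).log h)).add (((hc 0).mul (hc 1)).mul contDiffOn_const)).sub
    (contDiffOn_const.mul ((((hc 0).pow 2).mul contDiffOn_const).add
      (((hc 1).pow 2).mul contDiffOn_const)))

variable {n T A B}

/-- The maximizer of the log-likelihood over the open quadrant. -/
lemma isMaxOn_quadLogLik (hn : 0 < n) (hT : 0 < T) (hB : 0 < B) (hC : 0 < A - T ^ 2 / B) :
    let δ := (√(1 / n * (A - T ^ 2 / B)))⁻¹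
    !₂[δ, T * δ / B] ∈ posQuadrant ∧
      IsMaxOn (quadLogLik n T A B) posQuadrant !₂[δ, T * δ / B] := by
  intro δ
  have hδ : 0 < δ := inv_pos.2 (Real.sqrt_pos.2 (by positivity))
  have hδ2 : δ ^ 2 * (A - T ^ 2 / B) = n := by
    rw [inv_pow, Real.sq_sqrt (by positivity), one_div, mul_inv, inv_inv, mul_assoc,
      inv_mul_cancel₀ hC.ne', mul_one]
  refine ⟨⟨by simpa using hδ, by simp; positivity⟩, fun ρ hρ => ?_⟩
  obtain ⟨h0, -⟩ := hρ
  change quadLogLik n T A B ρ ≤ quadLogLik n T A B _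
  -- Completing the square in the second variable; the square vanishes at the estimator.
  have e : ∀ a b : ℝ, a * b * T - 1 / 2 * (a ^ 2 * A + b ^ 2 * B) =
      -(1 / 2) * (a ^ 2 * (A - T ^ 2 / B)) - 1 / 2 * B * (b - T * a / B) ^ 2 := fun a b => by
    field_simp
    ring
  -- `log s ≤ s - 1` is used at the squared ratio, so as to match the remaining quadratic term.
  have hl : Real.log (ρ 0) - Real.log δ ≤ 1 / 2 * (ρ 0 ^ 2 / δ ^ 2 - 1) := by
    have h1 := Real.log_le_sub_one_of_pos (x := ρ 0 ^ 2 / δ ^ 2) (by positivity)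
    rw [Real.log_div (by positivity) (by positivity), Real.log_pow, Real.log_pow] at h1
    push_cast at h1
    linarith
  have hl' : n * (Real.log (ρ 0) - Real.log δ) ≤ 1 / 2 * (ρ 0 ^ 2 * (A - T ^ 2 / B) - n) := by
    refine (mul_le_mul_of_nonneg_left hl hn.le).trans (le_of_eq ?_)
    have : A - T ^ 2 / B = n / δ ^ 2 := by
      rw [eq_div_iff (by positivity), mul_comm, hδ2]
    rw [this]
    field_simp
  have hq : 0 ≤ 1 / 2 * B * (ρ 1 - T * ρ 0 / B) ^ 2 := by positivity
  simp only [quadLogLik, add_sub_assoc, e, Matrix.cons_val_zero,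
    Matrix.cons_val_one, hδ2, sub_self]
  linarith

end LogLik

/-! ### The sufficient statistics and their measurability -/

section Increments

variable {Ω : Type*} {X : ℝ≥0 → Ω → ℝ} {h : ℕ → ℝ≥0}

/-- `∑ h_n² / Δ_j X`. -/
noncomputable def sumInvIncr (X : ℝ≥0 → Ω → ℝ) (h : ℕ → ℝ≥0) (n : ℕ) (ω : Ω) : ℝ :=
  ∑ j ∈ Finset.range n, (h n : ℝ) ^ 2 / incr X h n j ω

/-- `∑ Δ_j X`. -/
noncomputable def sumIncr (X : ℝ≥0 → Ω → ℝ) (h : ℕ → ℝ≥0) (n : ℕ) (ω : Ω) : ℝ :=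
  ∑ j ∈ Finset.range n, incr X h n j ω

lemma sumIncr_eq (n : ℕ) (ω : Ω) : sumIncr X h n ω = X (n * h n) ω - X 0 ω := by
  have := Finset.sum_range_sub (fun j : ℕ => X (j * h n) ω) n
  simpa [sumIncr, incr] using this

lemma igLogLik_eq (n : ℕ) (ω : Ω) : (fun ρ => igLogLik X h n ρ ω) =
    quadLogLik n (n * h n) (sumInvIncr X h n ω) (sumIncr X h n ω) := by
  ext ρ
  simp only [igLogLik, quadLogLik, sumInvIncr, sumIncr, Finset.sum_sub_distrib,
    Finset.sum_add_distrib, Finset.sum_const, Finset.card_range, ← Finset.mul_sum, nsmul_eq_mul,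
    mul_div_assoc]
  ring

lemma igLogLik_apply (n : ℕ) (ρ : EuclideanSpace ℝ (Fin 2)) (ω : Ω) : igLogLik X h n ρ ω =
    quadLogLik n (n * h n) (sumInvIncr X h n ω) (sumIncr X h n ω) ρ :=
  congrFun (igLogLik_eq n ω) ρ

lemma measurable_obsSigma {n j : ℕ} (hj : j ≤ n) : Measurable[obsSigma X h n] (X (j * h n)) := by
  have h1 : MeasurableSpace.comap (X (j * h n)) inferInstance ≤ obsSigma X h n :=
    le_iSup₂_of_le j (Finset.mem_range.2 (by omega)) le_rfl
  exact (comap_measurable _).mono h1 le_rfl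

lemma measurable_incr_obsSigma {n j : ℕ} (hj : j < n) :
    Measurable[obsSigma X h n] (incr X h n j) :=
  Measurable.sub (measurable_obsSigma hj) (measurable_obsSigma hj.le)

lemma measurable_sumInvIncr_obsSigma (n : ℕ) :
    Measurable[obsSigma X h n] (sumInvIncr X h n) := by
  refine Finset.measurable_fun_sum _ fun j hj => ?_
  have := measurable_incr_obsSigma (X := X) (h := h) (Finset.mem_range.1 hj)
  exact Measurable.div (@measurable_const _ _ _ (obsSigma X h n) _) this

lemma measurable_sumIncr_obsSigma (n : ℕ) : Measurable[obsSigma X h n] (sumIncr X h n) :=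
  Finset.measurable_fun_sum _ fun _ hj => measurable_incr_obsSigma (Finset.mem_range.1 hj)

lemma obsSigma_le [m : MeasurableSpace Ω] (hX : ∀ t, Measurable (X t)) (n : ℕ) :
    obsSigma X h n ≤ m :=
  iSup₂_le fun _ _ => (hX _).comap_le

/-- The estimator as a function of `∑ h_n² / Δ_j X` and of the end value of the process. -/
noncomputable def mleOf (n T A B : ℝ) : EuclideanSpace ℝ (Fin 2) :=
  !₂[(√(1 / n * (A - T ^ 2 / B)))⁻¹, T * (√(1 / n * (A - T ^ 2 / B)))⁻¹ / B]

lemma igMLE_eq (n : ℕ) (ω : Ω) :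
    igMLE X h n ω = mleOf n (n * h n) (sumInvIncr X h n ω) (X (n * h n) ω) := by
  simp [igMLE, mleOf, igDeltaHat, sumInvIncr]

end Increments

/-- The strict inequality between arithmetic and harmonic means: the difference is a weighted sum of
squared deviations of the increments from their mean, and these cannot all vanish when two
increments differ. -/
lemma sumInvIncr_sub_pos {Ω : Type*} {X : ℝ≥0 → Ω → ℝ} {h : ℕ → ℝ≥0} {n : ℕ}
    (hn : 0 < h n) (h2 : 2 ≤ n) {ω : Ω}
    (hpos : ∀ j, 0 < incr X h n j ω) (hne : incr X h n 0 ω ≠ incr X h n 1 ω) :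
    0 < sumInvIncr X h n ω - (n * h n : ℝ) ^ 2 / sumIncr X h n ω := by
  have hn0 : (0 : ℝ) < n := by exact_mod_cast (by omega : 0 < n)
  have hh : (0 : ℝ) < h n := by exact_mod_cast hn
  set B := sumIncr X h n ω with hB
  have hB0 : 0 < B := Finset.sum_pos (fun j _ => hpos j) ⟨0, Finset.mem_range.2 (by omega)⟩
  have e : sumInvIncr X h n ω - (n * h n : ℝ) ^ 2 / B = ∑ j ∈ Finset.range n,
      (h n : ℝ) ^ 2 * (incr X h n j ω - B / n) ^ 2 / (incr X h n j ω * (B / n) ^ 2) := by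
    have e1 : ∀ j ∈ Finset.range n,
        (h n : ℝ) ^ 2 * (incr X h n j ω - B / n) ^ 2 / (incr X h n j ω * (B / n) ^ 2) =
        (h n : ℝ) ^ 2 / (B / n) ^ 2 * incr X h n j ω - 2 * (h n : ℝ) ^ 2 / (B / n) +
          (h n : ℝ) ^ 2 / incr X h n j ω := fun j _ => by
      have := (hpos j).ne'
      field_simp
      ring
    rw [Finset.sum_congr rfl e1, Finset.sum_add_distrib, Finset.sum_sub_distrib,
      ← Finset.mul_sum, Finset.sum_const, Finset.card_range, nsmul_eq_mul]
    change _ = (h n : ℝ) ^ 2 / (B / n) ^ 2 * B - _ + sumInvIncr X h n ω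
    field_simp
    ring
  rw [e]
  have hterm : ∀ j, 0 ≤ (h n : ℝ) ^ 2 * (incr X h n j ω - B / n) ^ 2 /
      (incr X h n j ω * (B / n) ^ 2) := fun j => by
    have := hpos j
    positivity
  refine Finset.sum_pos' (fun j _ => hterm j) ?_
  have hex : ∃ j < n, incr X h n j ω ≠ B / n := by
    by_contra! hcon
    exact hne ((hcon 0 (by omega)).trans (hcon 1 (by omega)).symm)
  obtain ⟨j, hj, hjne⟩ := hex
  refine ⟨j, Finset.mem_range.2 hj, (hterm j).lt_of_ne' ?_⟩
  have h3 := (hpos j).ne'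
  have h4 := sub_ne_zero.2 hjne
  positivity

/-! ### Increments of the inverse-Gaussian subordinator -/

section Subordinator

variable {Ω : Type*} [MeasurableSpace Ω] {X : ℝ≥0 → Ω → ℝ} {h : ℕ → ℝ≥0} {P : Measure Ω}
  {δ γ : ℝ}

lemma IsIGSubordinator.measurable_incr (hX : IsIGSubordinator X P δ γ) (n j : ℕ) :
    Measurable (incr X h n j) :=
  (hX.measurable _).sub (hX.measurable _)

lemma IsIGSubordinator.map_incr (hX : IsIGSubordinator X P δ γ) {n : ℕ} (hn : 0 < h n) (j : ℕ) :
    P.map (incr X h n j) = igMeasure (δ * h n) γ := by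
  rw [← hX.law (h n) hn, ← (hX.stationary (j * h n) (h n)).map_eq]
  congr 1
  ext ω
  rw [incr]
  push_cast
  rw [add_mul, one_mul]

lemma IsIGSubordinator.iIndepFun_incr (hX : IsIGSubordinator X P δ γ) (n : ℕ) :
    iIndepFun (incr X h n) P :=
  hX.indep.nat (t := fun j : ℕ => (j : ℝ≥0) * h n) fun i j hij => by
    change (i : ℝ≥0) * h n ≤ j * h n
    gcongr

lemma IsIGSubordinator.ae_incr_pos (hX : IsIGSubordinator X P δ γ) {n : ℕ} (hn : 0 < h n) :
    ∀ᵐ ω ∂P, ∀ j, 0 < incr X h n j ω := by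
  refine ae_all_iff.2 fun j => ?_
  have := ae_pos_igMeasure (δ * h n) γ
  rw [← hX.map_incr hn j] at this
  exact ae_of_ae_map (hX.measurable_incr n j).aemeasurable this

lemma IsIGSubordinator.ae_eq_sumIncr (hX : IsIGSubordinator X P δ γ) (n : ℕ) :
    ∀ᵐ ω ∂P, X (n * h n) ω = sumIncr X h n ω := by
  filter_upwards [hX.zero] with ω hω
  rw [sumIncr_eq, hω, sub_zero]

/-- By Fubini the diagonal is null for a product measure whose second factor has no atoms. -/
lemma IndepFun.ae_ne {U V : Ω → ℝ} [IsProbabilityMeasure P] (hU : Measurable U)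
    (hV : Measurable V) (hUV : IndepFun U V P) [NullSingletonClass (P.map V)] :
    ∀ᵐ ω ∂P, U ω ≠ V ω := by
  have hd : MeasurableSet {p : ℝ × ℝ | p.1 = p.2} := measurableSet_eq_fun measurable_fst
    measurable_snd
  have := Measure.isProbabilityMeasure_map (μ := P) hU.aemeasurable
  have := Measure.isProbabilityMeasure_map (μ := P) hV.aemeasurable
  have h0 : P.map (fun ω => (U ω, V ω)) {p : ℝ × ℝ | p.1 = p.2} = 0 := by
    rw [(indepFun_iff_map_prod_eq_prod_map_map hU.aemeasurable hV.aemeasurable).1 hUV,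
      Measure.measure_prod_null hd]
    refine .of_forall fun x => ?_
    have : Prod.mk x ⁻¹' {p : ℝ × ℝ | p.1 = p.2} = {x} := by
      ext y; simp [eq_comm]
    change P.map V (Prod.mk x ⁻¹' {p : ℝ × ℝ | p.1 = p.2}) = 0
    rw [this]
    exact measure_singleton x
  rw [Measure.map_apply (hU.prodMk hV) hd] at h0
  exact measure_eq_zero_iff_ae_notMem.1 h0

lemma IsIGSubordinator.ae_incr_ne (hX : IsIGSubordinator X P δ γ) [IsProbabilityMeasure P]
    {n : ℕ} (hn : 0 < h n) : ∀ᵐ ω ∂P, incr X h n 0 ω ≠ incr X h n 1 ω := by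
  have : NullSingletonClass (P.map (incr X h n 1)) := by
    rw [hX.map_incr hn, igMeasure]
    infer_instance
  exact IndepFun.ae_ne (hX.measurable_incr n 0) (hX.measurable_incr n 1)
    ((hX.iIndepFun_incr n).indepFun (by norm_num))

lemma IsIGSubordinator.ae_isMaxOn (hX : IsIGSubordinator X P δ γ) [IsProbabilityMeasure P]
    {n : ℕ} (hn : 0 < h n) (h2 : 2 ≤ n) :
    ∀ᵐ ω ∂P, igMLE X h n ω ∈ posQuadrant ∧
      IsMaxOn (fun ρ => igLogLik X h n ρ ω) posQuadrant (igMLE X h n ω) := by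
  filter_upwards [hX.ae_incr_pos hn, hX.ae_incr_ne hn, hX.ae_eq_sumIncr n] with ω h3 h4 h5
  have hn0 : (0 : ℝ) < n := by exact_mod_cast (by omega : 0 < n)
  have hh : (0 : ℝ) < h n := by exact_mod_cast hn
  rw [igMLE_eq, igLogLik_eq, h5]
  exact isMaxOn_quadLogLik hn0 (by positivity)
    (Finset.sum_pos (fun j _ => h3 j) ⟨0, Finset.mem_range.2 (by omega)⟩)
    (sumInvIncr_sub_pos hn h2 h3 h4)

end Subordinator

/-! ### Deterministic expansion of the estimator -/

section Asymptotics

open Asymptotics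

variable {ι : Type*} {l : Filter ι}

lemma isBigO_one_of_abs_le {f : ι → ℝ} {C : ℝ} (h : ∀ᶠ i in l, |f i| ≤ C) :
    f =O[l] (fun _ => (1 : ℝ)) :=
  IsBigO.of_bound C (by simpa using h)

lemma tendsto_zero_mul_isBigO {f g : ι → ℝ} (hf : Tendsto f l (𝓝 0))
    (hg : g =O[l] (fun _ => (1 : ℝ))) : Tendsto (fun i => f i * g i) l (𝓝 0) := by
  have := ((isLittleO_one_iff ℝ).2 hf).mul_isBigO hg
  simp only [mul_one] at this
  exact (isLittleO_one_iff ℝ).1 this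

/-- The asymptotic expansion of the estimator on the event that the score is bounded. -/
lemma tendsto_mle_expansion {δ γ τ κ r z y w q : ι → ℝ} {c C M : ℝ} (hc : 0 < c)
    (hδ : ∀ᶠ i in l, c ≤ δ i ∧ δ i ≤ C) (hγ : ∀ᶠ i in l, 0 < γ i ∧ γ i ≤ C)
    (hz : ∀ᶠ i in l, |z i| ≤ M) (hy : ∀ᶠ i in l, |y i| ≤ M) (hτ : Tendsto τ l (𝓝 0))
    (hκ : Tendsto κ l (𝓝 0)) (hr : Tendsto r l (𝓝 0))
    (hpos : ∀ᶠ i in l, 0 < τ i ∧ 0 < κ i ∧ τ i = κ i * r i)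
    (hq : ∀ i, q i = √2 * z i + r i * (γ i * δ i * y i * (δ i - κ i * y i)⁻¹))
    (hw : ∀ i, w i = 1 - τ i * q i) :
    Tendsto (fun i => (δ i * (√(w i))⁻¹ - δ i) / τ i - δ i / √2 * z i) l (𝓝 0) ∧
    Tendsto (fun i => (γ i * (δ i - κ i * y i)⁻¹ * (δ i * (√(w i))⁻¹) - γ i) / κ i -
      γ i / δ i * y i) l (𝓝 0) := by
  have bδ : δ =O[l] (fun _ => (1 : ℝ)) := isBigO_one_of_abs_le (C := C)
    (hδ.mono fun i hi => by rw [abs_of_pos (by linarith)]; exact hi.2)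
  have bγ : γ =O[l] (fun _ => (1 : ℝ)) := isBigO_one_of_abs_le (C := C)
    (hγ.mono fun i hi => by rw [abs_of_pos hi.1]; exact hi.2)
  have bz := isBigO_one_of_abs_le hz
  have b_y := isBigO_one_of_abs_le hy
  have bδi : (fun i => (δ i)⁻¹) =O[l] (fun _ => (1 : ℝ)) := isBigO_one_of_abs_le (C := c⁻¹)
    (hδ.mono fun i hi => by
      rw [abs_of_pos (inv_pos.2 (by linarith))]
      exact inv_anti₀ hc hi.1)
  have hmul : ∀ {f g : ι → ℝ}, f =O[l] (fun _ => (1 : ℝ)) → g =O[l] (fun _ => (1 : ℝ)) →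
      (fun i => f i * g i) =O[l] (fun _ => (1 : ℝ)) := fun hf hg => by simpa using hf.mul hg
  have hκy := tendsto_zero_mul_isBigO hκ b_y
  have hden : ∀ᶠ i in l, c / 2 ≤ δ i - κ i * y i := by
    filter_upwards [hδ, hκy.eventually (Iio_mem_nhds (half_pos hc))] with i h1 h2
    have h3 : κ i * y i < c / 2 := h2
    linarith [h1.1]
  set u : ι → ℝ := fun i => (δ i - κ i * y i)⁻¹ with hu
  have bu : u =O[l] (fun _ => (1 : ℝ)) := isBigO_one_of_abs_le (C := (c / 2)⁻¹)
    (hden.mono fun i hi => by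
      rw [abs_of_pos (inv_pos.2 (by linarith))]
      exact inv_anti₀ (by positivity) hi)
  have hq0 : Tendsto (fun i => q i - √2 * z i) l (𝓝 0) := by
    have := tendsto_zero_mul_isBigO hr (hmul (hmul (hmul bγ bδ) b_y) bu)
    exact this.congr fun i => by rw [hq]; ring
  have bq : q =O[l] (fun _ => (1 : ℝ)) := by
    have h1 := hq0.isBigO_one ℝ
    exact (h1.add (bz.const_mul_left (√2))).congr_left fun i => by ring
  have hτq := tendsto_zero_mul_isBigO hτ bq
  have hw1 : Tendsto w l (𝓝 1) := by
    have := hτq.const_sub 1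
    rw [sub_zero] at this
    exact this.congr fun i => (hw i).symm
  have hs1 : Tendsto (fun i => √(w i)) l (𝓝 1) := by
    have := (Real.continuous_sqrt.tendsto 1).comp hw1
    rwa [Real.sqrt_one] at this
  -- Rationalising, `1/√w - 1 = (1 - w) v` with `1 - w = τ q`; since `v → 1/2`, the scaled error of
  -- `δ̂` is `δ q v ≈ δ z / √2`.
  set v : ι → ℝ := fun i => (√(w i) * (1 + √(w i)))⁻¹ with hv
  have hv0 : Tendsto (fun i => v i - 1 / 2) l (𝓝 0) := by
    have h1 := (hs1.mul (hs1.const_add 1)).inv₀ (by norm_num)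
    have h2 := h1.sub_const (1 / 2)
    norm_num at h2
    simpa [hv] using! h2
  have bv : v =O[l] (fun _ => (1 : ℝ)) := by
    have h1 := (hv0.isBigO_one ℝ).add (isBigO_refl (fun _ : ι => (1 : ℝ)) l |>.const_mul_left
      (1 / 2))
    exact h1.congr_left fun i => by ring
  have hwpos : ∀ᶠ i in l, 0 < w i := hw1.eventually (Ioi_mem_nhds one_pos)
  have key : ∀ᶠ i in l, (δ i * (√(w i))⁻¹ - δ i) / τ i = δ i * q i * v i := by
    filter_upwards [hwpos, hpos] with i hi hp
    have hs : 0 < √(w i) := Real.sqrt_pos.2 hi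
    have hsq : √(w i) ^ 2 = 1 - τ i * q i := by rw [Real.sq_sqrt hi.le, hw]
    have hτi := hp.1.ne'
    rw [hv]
    field_simp
    linear_combination (-δ i) * hsq
  constructor
  · have h1 := (tendsto_zero_mul_isBigO hv0 (hmul bδ bq)).add
      ((tendsto_zero_mul_isBigO hq0 bδ).const_mul (1 / 2))
    simp only [mul_zero, add_zero] at h1
    refine h1.congr' ?_
    filter_upwards [key] with i hi
    rw [hi]
    have : δ i / √2 * z i = 1 / 2 * (√2 * z i * δ i) := by
      have h2 : √2 ^ 2 = 2 := Real.sq_sqrt (by norm_num)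
      field_simp
      rw [h2]
      ring
    rw [this]
    ring
  -- The error of `δ̂` has scale `τ = κ r`, hence after division by `κ` contributes only a factor `r
  -- → 0`; the second summand is the error of replacing `1 / (δ - κ y)` by `1 / δ`.
  · have h1 := (tendsto_zero_mul_isBigO hr (hmul (hmul bγ (hmul (hmul bδ bq) bv)) bu)).add
      (tendsto_zero_mul_isBigO hκy (hmul (hmul (hmul bγ b_y) bu) bδi))
    rw [add_zero] at h1
    refine h1.congr' ?_
    filter_upwards [key, hpos, hδ, hden] with i hi hp hδi hdi
    have h2 : δ i * (√(w i))⁻¹ = δ i + τ i * (δ i * q i * v i) := by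
      rw [← hi, mul_div_cancel₀ _ hp.1.ne']
      ring
    have h3 : u i * (δ i - κ i * y i) = 1 := inv_mul_cancel₀ (by linarith)
    have h4 : δ i ≠ 0 := by linarith
    have h5 := hp.2.1.ne'
    change _ = (γ i * u i * (δ i * (√(w i))⁻¹) - γ i) / κ i - γ i / δ i * y i
    rw [h2, hp.2.2]
    field_simp
    linear_combination (-(δ i * γ i) - γ i * κ i * y i) * h3

end Asymptotics

/-! ### Diagonal matrices and Gaussian laws -/

section Diagonal

lemma toEuclideanLin_diagonal_apply (v : Fin 2 → ℝ) (x : EuclideanSpace ℝ (Fin 2)) :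
    Matrix.toEuclideanLin (Matrix.diagonal v) x = !₂[v 0 * x 0, v 1 * x 1] := by
  ext i
  fin_cases i <;> simp [Matrix.toLpLin_apply]

lemma lipschitzWith_toEuclideanLin_diagonal {v : Fin 2 → ℝ} {L : ℝ≥0} (h : ∀ i, |v i| ≤ L) :
    LipschitzWith L (Matrix.toEuclideanLin (Matrix.diagonal v)) := by
  refine LipschitzWith.of_dist_le_mul fun x y => ?_
  rw [dist_eq_norm, dist_eq_norm, ← map_sub, toEuclideanLin_diagonal_apply]
  refine abs_le_of_sq_le_sq' ?_ (by positivity) |>.2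
  rw [mul_pow, euclidean_norm_sq_two, euclidean_norm_sq_two]
  have h2 : ∀ i, v i ^ 2 ≤ (L : ℝ) ^ 2 := fun i => sq_le_sq' (by linarith [(abs_le.1 (h i)).1])
    (abs_le.1 (h i)).2
  simp only [Matrix.cons_val_zero, Matrix.cons_val_one, mul_pow, mul_add]
  exact add_le_add (mul_le_mul_of_nonneg_right (h2 0) (sq_nonneg _))
    (mul_le_mul_of_nonneg_right (h2 1) (sq_nonneg _))

/-- Writes the parameter-dependent limit law as the image of one fixed law, as the transfer lemma
requires; the characteristic functions agree because a diagonal map is self-adjoint. -/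
lemma multivariateGaussian_diagonal_sq (v : Fin 2 → ℝ) :
    multivariateGaussian 0 (Matrix.diagonal fun i => v i ^ 2) =
      (stdGaussian (EuclideanSpace ℝ (Fin 2))).map
        (Matrix.toEuclideanLin (Matrix.diagonal v)) := by
  have hm : Measurable (Matrix.toEuclideanLin (Matrix.diagonal v)) :=
    (Matrix.toEuclideanLin (Matrix.diagonal v)).continuous_of_finiteDimensional.measurable
  have := Measure.isProbabilityMeasure_map
    (μ := stdGaussian (EuclideanSpace ℝ (Fin 2))) hm.aemeasurable
  apply Measure.ext_of_charFun
  ext t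
  rw [charFun_multivariateGaussian (Matrix.PosSemidef.diagonal fun i => sq_nonneg (v i)),
    charFun_apply, integral_map hm.aemeasurable (Measurable.aestronglyMeasurable (by fun_prop))]
  have e : ∀ x, inner ℝ (Matrix.toEuclideanLin (Matrix.diagonal v) x) t =
      inner ℝ x (Matrix.toEuclideanLin (Matrix.diagonal v) t) := fun x => by
    simp only [toEuclideanLin_diagonal_apply, PiLp.inner_apply, Fin.sum_univ_two]
    simp
    ring
  simp_rw [e]
  rw [← charFun_apply, charFun_stdGaussian, toEuclideanLin_diagonal_apply, ← Complex.ofReal_pow,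
    euclidean_norm_sq_two]
  congr 1
  simp [Matrix.mulVec_diagonal, dotProduct, Fin.sum_univ_two]
  ring

lemma inv_diagonal_two {v w : Fin 2 → ℝ} (h : ∀ i, v i * w i = 1) :
    (Matrix.diagonal v)⁻¹ = Matrix.diagonal w := by
  refine Matrix.inv_eq_right_inv ?_
  rw [Matrix.diagonal_mul_diagonal]
  simp [h]

variable {θ : EuclideanSpace ℝ (Fin 2)}

lemma igFisher_eq (h0 : 0 < θ 0) (h1 : 0 < θ 1) :
    igFisher θ = Matrix.diagonal fun i => ![√2 / θ 0, √(θ 0 / θ 1)] i ^ 2 := by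
  rw [igFisher]
  congr 1
  ext i
  fin_cases i
  · simp [div_pow]
  · simp [Real.sq_sqrt (div_pos h0 h1).le]

lemma inv_igFisher_eq (h0 : 0 < θ 0) (h1 : 0 < θ 1) :
    (igFisher θ)⁻¹ = Matrix.diagonal fun i => ![θ 0 / √2, √(θ 1 / θ 0)] i ^ 2 := by
  rw [igFisher]
  refine inv_diagonal_two fun i => ?_
  fin_cases i
  · change 2 / θ 0 ^ 2 * (θ 0 / √2) ^ 2 = 1
    rw [div_pow, Real.sq_sqrt (by norm_num)]
    field_simp
  · simp [Real.sq_sqrt (div_pos h1 h0).le]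
    field_simp

lemma posDef_igFisher (h0 : 0 < θ 0) (h1 : 0 < θ 1) : (igFisher θ).PosDef := by
  refine Matrix.PosDef.diagonal fun i => ?_
  fin_cases i
  · simp; positivity
  · simp; positivity

end Diagonal

/-! ### Observability of the score, the information and the estimator -/

section Observable

variable {Ω : Type*} {X : ℝ≥0 → Ω → ℝ} {h : ℕ → ℝ≥0}

/-- The end value `X_T` is listed beside the sum of the increments because the two agree only almost
surely. -/
lemma measurable_of_statistics {E : Type*} [MeasurableSpace E] {n : ℕ} {g : ℝ × ℝ × ℝ → E}
    (hg : Measurable g) : Measurable[obsSigma X h n] fun ω =>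
      g (sumInvIncr X h n ω, sumIncr X h n ω, X (n * h n) ω) := by
  have h1 := measurable_sumInvIncr_obsSigma (X := X) (h := h) n
  have h2 := measurable_sumIncr_obsSigma (X := X) (h := h) n
  have h3 := measurable_obsSigma (X := X) (h := h) (le_refl n)
  exact hg.comp (Measurable.prodMk h1 (Measurable.prodMk h2 h3))

lemma measurable_vec_two {α : Type*} [MeasurableSpace α] {f g : α → ℝ} (hf : Measurable f)
    (hg : Measurable g) : Measurable fun x => !₂[f x, g x] := by
  refine (WithLp.measurable_toLp 2 _).comp (measurable_pi_iff.2 fun i => ?_)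
  fin_cases i
  · simpa using hf
  · simpa using hg

lemma measurable_toEuclideanLin (M : Matrix (Fin 2) (Fin 2) ℝ) :
    Measurable (Matrix.toEuclideanLin M) :=
  (Matrix.toEuclideanLin M).continuous_of_finiteDimensional.measurable

lemma measurable_score {θ : EuclideanSpace ℝ (Fin 2)} (hθ : θ 0 ≠ 0) (n : ℕ)
    (M : Matrix (Fin 2) (Fin 2) ℝ) : Measurable[obsSigma X h n] fun ω =>
      Matrix.toEuclideanLin M (scoreFun (fun ρ => igLogLik X h n ρ ω) θ) := by
  simp_rw [igLogLik_eq, scoreFun_quadLogLik _ _ _ _ hθ]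
  exact measurable_of_statistics (g := fun p => Matrix.toEuclideanLin M
    !₂[n / θ 0 + θ 1 * (n * h n) - θ 0 * p.1, θ 0 * (n * h n) - θ 1 * p.2.1])
    ((measurable_toEuclideanLin M).comp (measurable_vec_two (by fun_prop) (by fun_prop)))

lemma measurable_mle (θ : EuclideanSpace ℝ (Fin 2)) (n : ℕ)
    (M : Matrix (Fin 2) (Fin 2) ℝ) : Measurable[obsSigma X h n] fun ω =>
      Matrix.toEuclideanLin M (igMLE X h n ω - θ) := by
  simp_rw [igMLE_eq]
  refine measurable_of_statistics (g := fun p => Matrix.toEuclideanLin M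
    (mleOf n (n * h n) p.1 p.2.2 - θ)) ((measurable_toEuclideanLin M).comp ?_)
  exact (measurable_vec_two (by fun_prop) (by fun_prop)).sub_const θ

lemma scaled_info_apply {θ : EuclideanSpace ℝ (Fin 2)} (hθ : θ 0 ≠ 0) (n : ℕ) (ω : Ω)
    (v : Fin 2 → ℝ) (i j : Fin 2) : (Matrix.diagonal v *
      observedInfo (fun ρ => igLogLik X h n ρ ω) θ * Matrix.diagonal v) i j =
      v i * !![n / θ 0 ^ 2 + sumInvIncr X h n ω, -(n * h n : ℝ); -(n * h n : ℝ),
        sumIncr X h n ω] i j * v j := by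
  rw [igLogLik_eq, observedInfo_quadLogLik _ _ _ _ hθ, Matrix.mul_diagonal, Matrix.diagonal_mul]

lemma measurable_info {θ : EuclideanSpace ℝ (Fin 2)} (hθ : θ 0 ≠ 0) (n : ℕ) (v : Fin 2 → ℝ)
    (i j : Fin 2) : Measurable[obsSigma X h n] fun ω => (Matrix.diagonal v *
      observedInfo (fun ρ => igLogLik X h n ρ ω) θ * Matrix.diagonal v) i j := by
  simp_rw [scaled_info_apply hθ]
  refine measurable_of_statistics (g := fun p => v i * !![n / θ 0 ^ 2 + p.1, -(n * h n : ℝ);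
    -(n * h n : ℝ), p.2.1] i j * v j) (Measurable.mul_const (Measurable.const_mul ?_ _) _)
  fin_cases i <;> fin_cases j <;> simp <;> fun_prop

/-- The remainder of the quadratic expansion of the log-likelihood is not random. -/
lemma igLogLik_expansion {θ : EuclideanSpace ℝ (Fin 2)} (hθ : θ 0 ≠ 0) (n : ℕ) (ω : Ω)
    (v : EuclideanSpace ℝ (Fin 2)) :
    igLogLik X h n (θ + v) ω - igLogLik X h n θ ω -
      (∑ i, scoreFun (fun ρ => igLogLik X h n ρ ω) θ i * v i -
        1 / 2 * ∑ i, ∑ j, observedInfo (fun ρ => igLogLik X h n ρ ω) θ i j * v i * v j) =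
      n * (Real.log (θ 0 + v 0) - Real.log (θ 0) - v 0 / θ 0 + v 0 ^ 2 / (2 * θ 0 ^ 2)) := by
  rw [igLogLik_apply, igLogLik_apply, igLogLik_eq, scoreFun_quadLogLik _ _ _ _ hθ,
    observedInfo_quadLogLik _ _ _ _ hθ]
  simp only [Fin.sum_univ_two, quadLogLik]
  simp
  field_simp
  ring

lemma measurable_igLogLik_obsSigma (n : ℕ) (θ : EuclideanSpace ℝ (Fin 2)) :
    Measurable[obsSigma X h n] (igLogLik X h n θ) := by
  have e : igLogLik X h n θ = fun ω => quadLogLik n (n * h n) (sumInvIncr X h n ω)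
      (sumIncr X h n ω) θ := funext fun ω => igLogLik_apply n θ ω
  rw [e]
  exact measurable_of_statistics (g := fun p => quadLogLik n (n * h n) p.1 p.2.1 θ)
    (by unfold quadLogLik; fun_prop)

end Observable

/-! ### The statistics as affine functions of the standardised score -/

section NormScore

variable {Ω : Type*} {X : ℝ≥0 → Ω → ℝ} {h : ℕ → ℝ≥0}

/-- The standardised score. -/
noncomputable def normScore (X : ℝ≥0 → Ω → ℝ) (h : ℕ → ℝ≥0) (n : ℕ)
    (θ : EuclideanSpace ℝ (Fin 2)) (ω : Ω) : EuclideanSpace ℝ (Fin 2) :=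
  (√(n : ℝ))⁻¹ • ∑ j ∈ Finset.range n, igScore (θ 0 * h n) (θ 1) (incr X h n j ω)

lemma normScore_zero (n : ℕ) (θ : EuclideanSpace ℝ (Fin 2)) (ω : Ω) :
    normScore X h n θ ω 0 = (√(n : ℝ))⁻¹ *
      ((n * (1 + θ 1 * (θ 0 * h n)) - θ 0 ^ 2 * sumInvIncr X h n ω) / √2) := by
  have e : (∑ j ∈ Finset.range n, igScore (θ 0 * h n) (θ 1) (incr X h n j ω)) 0 =
      ∑ j ∈ Finset.range n,
        (1 + θ 1 * (θ 0 * h n) - (θ 0 * h n) ^ 2 * (incr X h n j ω)⁻¹) / √2 := by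
    simp [igScore]
  rw [normScore, PiLp.smul_apply, smul_eq_mul, e, ← Finset.sum_div, Finset.sum_sub_distrib,
    Finset.sum_const, Finset.card_range, nsmul_eq_mul, sumInvIncr, Finset.mul_sum]
  simp only [mul_pow, mul_assoc, div_eq_mul_inv]

lemma normScore_one {n : ℕ} (hn : 0 < h n) {θ : EuclideanSpace ℝ (Fin 2)} (h0 : 0 < θ 0)
    (h1 : 0 < θ 1) (ω : Ω) :
    √(θ 0 / θ 1) * normScore X h n θ ω 1 =
      1 / √(n * h n : ℝ) * (θ 0 * (n * h n) - θ 1 * sumIncr X h n ω) := by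
  have e : (∑ j ∈ Finset.range n, igScore (θ 0 * h n) (θ 1) (incr X h n j ω)) 1 =
      ∑ j ∈ Finset.range n, √(θ 1 / (θ 0 * h n)) * (θ 0 * h n - θ 1 * incr X h n j ω) := by
    simp [igScore]
  have hh : (0 : ℝ) < h n := by exact_mod_cast hn
  have e2 : √(θ 0 / θ 1) * √(θ 1 / (θ 0 * h n)) = (√(h n : ℝ))⁻¹ := by
    rw [← Real.sqrt_mul (by positivity), ← Real.sqrt_inv]
    congr 1
    field_simp
  rw [normScore, PiLp.smul_apply, smul_eq_mul, e, ← Finset.mul_sum, Finset.sum_sub_distrib,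
    Finset.sum_const, Finset.card_range, nsmul_eq_mul, ← Finset.mul_sum, ← sumIncr,
    Real.sqrt_mul (by positivity), one_div, mul_inv, ← e2]
  ring

lemma sumInvIncr_eq {n : ℕ} (hn : 0 < n) {θ : EuclideanSpace ℝ (Fin 2)} (h0 : 0 < θ 0) (ω : Ω) :
    sumInvIncr X h n ω = n * (1 + θ 1 * θ 0 * h n -
      √2 * (1 / √(n : ℝ)) * normScore X h n θ ω 0) / θ 0 ^ 2 := by
  have hn' : (0 : ℝ) < n := by exact_mod_cast hn
  have hs : √(n : ℝ) ^ 2 = n := Real.sq_sqrt hn'.le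
  have hs0 : 0 < √(n : ℝ) := Real.sqrt_pos.2 hn'
  rw [normScore_zero]
  field_simp
  rw [hs]
  field_simp
  ring

lemma sumIncr_eq_of_normScore {n : ℕ} (hn0 : 0 < n) (hn : 0 < h n)
    {θ : EuclideanSpace ℝ (Fin 2)} (h0 : 0 < θ 0) (h1 : 0 < θ 1) (ω : Ω) :
    sumIncr X h n ω = n * h n * (θ 0 - 1 / √(n * h n : ℝ) *
      (√(θ 0 / θ 1) * normScore X h n θ ω 1)) / θ 1 := by
  have hn' : (0 : ℝ) < n := by exact_mod_cast hn0
  have hh : (0 : ℝ) < h n := by exact_mod_cast hn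
  have hs : √(n * h n : ℝ) ^ 2 = n * h n := Real.sq_sqrt (by positivity)
  have hs0 : 0 < √(n * h n : ℝ) := Real.sqrt_pos.2 (by positivity)
  rw [normScore_one hn h0 h1, ← mul_assoc, ← sq, div_pow, one_pow, hs]
  field_simp
  ring

/-- An exact identity, so the limit law of the score requires no remainder estimate. -/
lemma scaled_score_eq {n : ℕ} (hn : 0 < h n) {θ : EuclideanSpace ℝ (Fin 2)}
    (h0 : 0 < θ 0) (h1 : 0 < θ 1) (hn0 : 0 < n) (ω : Ω) :
    Matrix.toEuclideanLin (Matrix.diagonal (igRate h n))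
      (scoreFun (fun ρ => igLogLik X h n ρ ω) θ) =
    Matrix.toEuclideanLin (Matrix.diagonal ![√2 / θ 0, √(θ 0 / θ 1)]) (normScore X h n θ ω) := by
  have hn' : (0 : ℝ) < n := by exact_mod_cast hn0
  have hs0 : 0 < √(n : ℝ) := Real.sqrt_pos.2 hn'
  rw [igLogLik_eq, scoreFun_quadLogLik _ _ _ _ h0.ne', toEuclideanLin_diagonal_apply,
    toEuclideanLin_diagonal_apply]
  congr 1
  ext i
  fin_cases i
  · simp [normScore_zero, igRate]
    field_simp
  · simp [igRate, normScore_one hn h0 h1]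

end NormScore

lemma tendsto_one_div_sqrt_natCast : Tendsto (fun n : ℕ => 1 / √(n : ℝ)) atTop (𝓝 0) := by
  have := (Real.tendsto_sqrt_atTop.comp (tendsto_natCast_atTop_atTop (R := ℝ))).inv_tendsto_atTop
  exact this.congr fun n => by simp

/-! ### Limits along sequences of parameters in a compact set -/

section Sequences

variable {Ω : Type*} [MeasurableSpace Ω] {X : ℝ≥0 → Ω → ℝ} {h : ℕ → ℝ≥0} {P : ℕ → Measure Ω}
  {θ : ℕ → EuclideanSpace ℝ (Fin 2)} {c C : ℝ}

lemma measurable_normScore (hX : ∀ t, Measurable (X t)) (n : ℕ) (θ : EuclideanSpace ℝ (Fin 2)) :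
    Measurable (normScore X h n θ) := by
  have hm : ∀ j, Measurable fun ω => igScore (θ 0 * h n) (θ 1) (incr X h n j ω) := fun j =>
    (measurable_igScore _ _).comp ((hX _).sub (hX _))
  exact (Finset.measurable_fun_sum _ fun j _ => hm j).const_smul (√(n : ℝ))⁻¹

/-- With `d = δ h`, the bounds `dγ ≤ C² h` and `n dγ ≥ c² T` translate `h → 0` and `T → ∞` into the
two limits the central limit theorem asks for. -/
lemma tendsto_charFun_normScore (hc : 0 < c) (hθ : ∀ n i, c ≤ θ n i ∧ θ n i ≤ C)
    (hX : ∀ n, IsIGSubordinator X (P n) (θ n 0) (θ n 1)) (h_pos : ∀ n, 0 < h n)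
    (hT : Tendsto (fun n => (n * h n : ℝ)) atTop atTop) (h_zero : Tendsto h atTop (𝓝 0))
    (t : EuclideanSpace ℝ (Fin 2)) :
    Tendsto (fun n => charFun ((P n).map (normScore X h n (θ n))) t) atTop
      (𝓝 (charFun (stdGaussian (EuclideanSpace ℝ (Fin 2))) t)) := by
  have hp : ∀ n i, 0 < θ n i := fun n i => hc.trans_le (hθ n i).1
  have hh : ∀ n, (0 : ℝ) < h n := fun n => by exact_mod_cast h_pos n
  have hC : 0 < C := hc.trans_le ((hθ 0 0).1.trans (hθ 0 0).2)
  have hz : Tendsto (fun n => (h n : ℝ)) atTop (𝓝 0) := by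
    simpa using NNReal.tendsto_coe.2 h_zero
  refine tendsto_charFun_igScore (fun n => mul_pos (hp n 0) (hh n)) (fun n => hp n 1) ?_ ?_
    (fun n j => (hX n).measurable_incr n j) (fun n => (hX n).iIndepFun_incr n)
    (fun n j => (hX n).map_incr (h_pos n) j) t
  · have h1 : Tendsto (fun n => C * h n * C) atTop (𝓝 0) := by
      simpa using (hz.const_mul C).mul_const C
    refine squeeze_zero (fun n => ?_) (fun n => ?_) h1
    · have := hp n 0; have := hp n 1; have := hh n
      positivity
    · have h2 := (hθ n 0).2; have h3 := (hθ n 1).2; have := hh n; have := hp n 1; have := hp n 0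
      gcongr
  · have h1 : Tendsto (fun n : ℕ => (n * h n : ℝ) * c ^ 2) atTop atTop :=
      hT.atTop_mul_const (by positivity)
    refine tendsto_atTop_mono (fun n => ?_) h1
    have h2 := (hθ n 0).1; have h3 := (hθ n 1).1; have := hh n; have := hp n 0
    calc (n * h n : ℝ) * c ^ 2 = n * (c * h n * c) := by ring
      _ ≤ n * (θ n 0 * h n * θ n 1) := by gcongr

/-- Hypotheses on a sequence of models, with parameters in a compact part of the quadrant. -/
structure IGSequence (X : ℝ≥0 → Ω → ℝ) (h : ℕ → ℝ≥0) (P : ℕ → Measure Ω)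
    (θ : ℕ → EuclideanSpace ℝ (Fin 2)) (c C : ℝ) : Prop where
  pos : 0 < c
  bounds : ∀ n i, c ≤ θ n i ∧ θ n i ≤ C
  prob : ∀ n, IsProbabilityMeasure (P n)
  ig : ∀ n, IsIGSubordinator X (P n) (θ n 0) (θ n 1)
  h_pos : ∀ n, 0 < h n
  T_tendsto : Tendsto (fun n => (n * h n : ℝ)) atTop atTop
  h_tendsto : Tendsto h atTop (𝓝 0)

namespace IGSequence

variable (H : IGSequence X h P θ c C)
include H

lemma param_pos (n : ℕ) (i : Fin 2) : 0 < θ n i := H.pos.trans_le (H.bounds n i).1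

lemma C_pos : 0 < C := H.pos.trans_le ((H.bounds 0 0).1.trans (H.bounds 0 0).2)

lemma hh (n : ℕ) : (0 : ℝ) < h n := by exact_mod_cast H.h_pos n

lemma measurable_normScore (n : ℕ) : Measurable (normScore X h n (θ n)) :=
  _root_.measurable_normScore (H.ig n).measurable n _

lemma tightSeq : TightSeq P fun n => normScore X h n (θ n) :=
  tightSeq_of_tendsto_charFun (ν := ⟨stdGaussian (EuclideanSpace ℝ (Fin 2)), inferInstance⟩)
    H.prob H.measurable_normScore
    (tendsto_charFun_normScore H.pos H.bounds H.ig H.h_pos H.T_tendsto H.h_tendsto)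

lemma tendsto_blDist {ζ : ℕ → Ω → EuclideanSpace ℝ (Fin 2)} {v : ℕ → Fin 2 → ℝ} {L : ℝ≥0}
    (hv : ∀ n i, |v n i| ≤ L) (hζ : ∀ n, Measurable (ζ n))
    (hb : ∀ M, Tendsto (fun p : ℕ × Ω => ζ p.1 p.2 - Matrix.toEuclideanLin
      (Matrix.diagonal (v p.1)) (normScore X h p.1 (θ p.1) p.2))
      (boundedFilter (fun n => normScore X h n (θ n)) M) (𝓝 0)) :
    Tendsto (fun n => blDist (P n) (ζ n)
      (multivariateGaussian 0 (Matrix.diagonal fun i => v n i ^ 2))) atTop (𝓝 0) := by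
  simp_rw [multivariateGaussian_diagonal_sq]
  exact tendsto_blDist_of_boundedFilter
    (ν := ⟨stdGaussian (EuclideanSpace ℝ (Fin 2)), inferInstance⟩) H.prob H.measurable_normScore
    H.tightSeq (fun ε hε => eventually_levyProkhorovEDist_lt_of_tendsto_charFun
      (ν := ⟨stdGaussian (EuclideanSpace ℝ (Fin 2)), inferInstance⟩) H.prob
      H.measurable_normScore (tendsto_charFun_normScore H.pos H.bounds H.ig H.h_pos H.T_tendsto
        H.h_tendsto) hε)
    (.of_forall fun n => (hζ n).aestronglyMeasurable)
    (fun n => lipschitzWith_toEuclideanLin_diagonal (hv n)) hb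

lemma tendsto_score :
    Tendsto (fun n => blDist (P n) (fun ω => Matrix.toEuclideanLin
      (Matrix.diagonal (igRate h n)) (scoreFun (fun ρ => igLogLik X h n ρ ω) (θ n)))
      (multivariateGaussian 0 (igFisher (θ n)))) atTop (𝓝 0) := by
  have e := fun n => igFisher_eq (H.param_pos n 0) (H.param_pos n 1)
  simp_rw [e]
  have hc := H.pos
  have hC := H.C_pos
  refine H.tendsto_blDist (v := fun n => ![√2 / θ n 0, √(θ n 0 / θ n 1)])
    (L := Real.toNNReal (√2 / c + √(C / c))) (fun n i => ?_)
    (fun n => (measurable_score (H.param_pos n 0).ne' n _).mono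
      (obsSigma_le (H.ig n).measurable n) le_rfl) (fun M => ?_)
  · rw [Real.coe_toNNReal _ (by positivity)]
    have h0 := H.param_pos n 0
    have h1 := H.param_pos n 1
    have b0 := H.bounds n 0
    have b1 := H.bounds n 1
    have i1 : √2 / θ n 0 ≤ √2 / c := by gcongr; exact b0.1
    have i2 : √(θ n 0 / θ n 1) ≤ √(C / c) := by
      gcongr
      · exact b0.2
      · exact b1.1
    fin_cases i
    · change |√2 / θ n 0| ≤ _
      rw [abs_of_pos (by positivity)]
      linarith [Real.sqrt_nonneg (C / c)]
    · change |√(θ n 0 / θ n 1)| ≤ _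
      rw [abs_of_pos (by positivity)]
      have : 0 ≤ √2 / c := by positivity
      linarith
  · refine tendsto_const_nhds.congr' (eventually_boundedFilter.2 ?_)
    filter_upwards [eventually_gt_atTop 0] with n hn ω _
    rw [scaled_score_eq (H.h_pos n) (H.param_pos n 0) (H.param_pos n 1) hn, sub_self]

lemma tendsto_rate_one : Tendsto (fun n : ℕ => 1 / √(n * h n : ℝ)) atTop (𝓝 0) := by
  have := (Real.tendsto_sqrt_atTop.comp H.T_tendsto).inv_tendsto_atTop
  exact this.congr fun n => by simp

lemma tendsto_h : Tendsto (fun n => (h n : ℝ)) atTop (𝓝 0) := by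
  simpa using NNReal.tendsto_coe.2 H.h_tendsto

lemma tendsto_sqrt_h : Tendsto (fun n => √(h n : ℝ)) atTop (𝓝 0) := by
  have := (Real.continuous_sqrt.tendsto 0).comp H.tendsto_h
  rwa [Real.sqrt_zero] at this

lemma rate_eq {n : ℕ} (hn : 0 < n) :
    0 < 1 / √(n : ℝ) ∧ 0 < 1 / √(n * h n : ℝ) ∧
      1 / √(n : ℝ) = 1 / √(n * h n : ℝ) * √(h n : ℝ) := by
  have hn' : (0 : ℝ) < n := by exact_mod_cast hn
  have := H.hh n
  have hs := Real.sqrt_pos.2 this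
  refine ⟨by positivity, by positivity, ?_⟩
  rw [Real.sqrt_mul hn'.le]
  field_simp

lemma normScore_bounds (M : ℝ) :
    ∃ M', ∀ᶠ p in boundedFilter (fun n => normScore X h n (θ n)) M,
      |normScore X h p.1 (θ p.1) p.2 0| ≤ M' ∧
      |√(θ p.1 0 / θ p.1 1) * normScore X h p.1 (θ p.1) p.2 1| ≤ M' := by
  have hc := H.pos
  have hC := H.C_pos
  -- `M` ranges over all reals, hence the absolute value.
  refine ⟨|M| + √(C / c) * |M|, eventually_boundedFilter.2 (.of_forall fun n ω hω => ?_)⟩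
  have hω' := hω.trans (le_abs_self M)
  have h0 := (PiLp.norm_apply_le (normScore X h n (θ n) ω) 0).trans hω'
  have h1 := (PiLp.norm_apply_le (normScore X h n (θ n) ω) 1).trans hω'
  rw [Real.norm_eq_abs] at h0 h1
  constructor
  · exact h0.trans (le_add_of_nonneg_right (by positivity))
  · have b0 := (H.bounds n 0).2
    have b1 := (H.bounds n 1).1
    rw [abs_mul, abs_of_nonneg (Real.sqrt_nonneg _)]
    calc _ ≤ √(C / c) * |M| := by gcongr
      _ ≤ _ := le_add_of_nonneg_left (abs_nonneg M)

lemma tendsto_probDist {ζ : ℕ → Ω → ℝ} {b : ℕ → ℝ}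
    (hb : ∀ M, Tendsto (fun p : ℕ × Ω => ζ p.1 p.2 - b p.1)
      (boundedFilter (fun n => normScore X h n (θ n)) M) (𝓝 0)) :
    Tendsto (fun n => probDist (P n) (ζ n) (b n)) atTop (𝓝 0) :=
  tendsto_probDist_of_boundedFilter H.prob H.measurable_normScore H.tightSeq hb

lemma isBigO_inv_param {l : Filter (ℕ × Ω)} (i : Fin 2) :
    (fun p : ℕ × Ω => (θ p.1 i)⁻¹) =O[l] (fun _ => (1 : ℝ)) :=
  isBigO_one_of_abs_le (C := c⁻¹) (.of_forall fun p => by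
    rw [abs_of_pos (inv_pos.2 (H.param_pos _ _))]
    exact inv_anti₀ H.pos (H.bounds _ _).1)

lemma isBigO_param {l : Filter (ℕ × Ω)} (i : Fin 2) :
    (fun p : ℕ × Ω => θ p.1 i) =O[l] (fun _ => (1 : ℝ)) :=
  isBigO_one_of_abs_le (C := C) (.of_forall fun p => by
    rw [abs_of_pos (H.param_pos _ _)]
    exact (H.bounds _ _).2)

/-- The diagonal entries minus their limits are coordinates of the standardised score with vanishing
coefficients, plus `h γ / δ` in the first one. The off-diagonal entries are deterministic: `-T / √(n
T) = -√h`. -/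
lemma tendsto_info (i j : Fin 2) :
    Tendsto (fun n => probDist (P n) (fun ω => (Matrix.diagonal (igRate h n) *
      observedInfo (fun ρ => igLogLik X h n ρ ω) (θ n) * Matrix.diagonal (igRate h n)) i j)
      (igFisher (θ n) i j)) atTop (𝓝 0) := by
  refine H.tendsto_probDist fun M => ?_
  obtain ⟨M', hM'⟩ := H.normScore_bounds M
  have hfst := tendsto_fst_boundedFilter (Z := fun n => normScore X h n (θ n)) (M := M)
  have hmul : ∀ {f g : ℕ × Ω → ℝ} {l : Filter (ℕ × Ω)}, f =O[l] (fun _ => (1 : ℝ)) →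
      g =O[l] (fun _ => (1 : ℝ)) → (fun i => f i * g i) =O[l] (fun _ => (1 : ℝ)) :=
    fun hf hg => by simpa using hf.mul hg
  have hdiag := (H.tendsto_sqrt_h.comp hfst).neg
  rw [neg_zero] at hdiag
  fin_cases i <;> fin_cases j
  · have h1 := (tendsto_zero_mul_isBigO (H.tendsto_h.comp hfst) (hmul (H.isBigO_param 1)
      (H.isBigO_inv_param 0))).sub ((tendsto_zero_mul_isBigO
        (tendsto_one_div_sqrt_natCast.comp hfst)
        (hmul (isBigO_one_of_abs_le (hM'.mono fun _ h => h.1))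
          (hmul (H.isBigO_inv_param 0) (H.isBigO_inv_param 0)))).const_mul √2)
    rw [mul_zero, sub_zero] at h1
    refine h1.congr' (eventually_boundedFilter.2 ?_)
    filter_upwards [eventually_gt_atTop 0] with n hn ω _
    have hn' : (0 : ℝ) < n := by exact_mod_cast hn
    have h0 := H.param_pos n 0
    have hs : √(n : ℝ) ^ 2 = n := Real.sq_sqrt hn'.le
    have hs0 := Real.sqrt_pos.2 hn'
    rw [scaled_info_apply h0.ne', sumInvIncr_eq hn h0]
    set z := normScore X h n (θ n) ω 0
    have e : 1 / √(n : ℝ) * (n / θ n 0 ^ 2 + n * (1 + θ n 1 * θ n 0 * h n -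
        √2 * (1 / √(n : ℝ)) * z) / θ n 0 ^ 2) * (1 / √(n : ℝ)) - 2 / θ n 0 ^ 2 =
        h n * (θ n 1 * (θ n 0)⁻¹) - √2 * (1 / √(n : ℝ) * (z * ((θ n 0)⁻¹ * (θ n 0)⁻¹))) := by
      generalize √(n : ℝ) = s at *
      rw [← hs]
      field_simp
      ring
    exact e.symm
  · refine hdiag.congr' (eventually_boundedFilter.2 ?_)
    filter_upwards [eventually_gt_atTop 0] with n hn ω _
    have hn' : (0 : ℝ) < n := by exact_mod_cast hn
    have hs0 := Real.sqrt_pos.2 hn'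
    have hh0 := Real.sqrt_pos.2 (H.hh n)
    rw [scaled_info_apply (H.param_pos n 0).ne']
    have hs : √(n : ℝ) ^ 2 = n := Real.sq_sqrt hn'.le
    have hsh : √(h n : ℝ) ^ 2 = h n := Real.sq_sqrt (H.hh n).le
    simp [igRate, igFisher]
    field_simp
    rw [hs, hsh]
    ring
  · refine hdiag.congr' (eventually_boundedFilter.2 ?_)
    filter_upwards [eventually_gt_atTop 0] with n hn ω _
    have hn' : (0 : ℝ) < n := by exact_mod_cast hn
    have hs0 := Real.sqrt_pos.2 hn'
    have hh0 := Real.sqrt_pos.2 (H.hh n)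
    rw [scaled_info_apply (H.param_pos n 0).ne']
    have hs : √(n : ℝ) ^ 2 = n := Real.sq_sqrt hn'.le
    have hsh : √(h n : ℝ) ^ 2 = h n := Real.sq_sqrt (H.hh n).le
    simp [igRate, igFisher]
    field_simp
    rw [hs, hsh]
    ring
  · have h1 := (tendsto_zero_mul_isBigO (H.tendsto_rate_one.comp hfst)
        (hmul (isBigO_one_of_abs_le (hM'.mono fun _ h => h.2)) (H.isBigO_inv_param 1))).neg
    rw [neg_zero] at h1
    refine h1.congr' (eventually_boundedFilter.2 ?_)
    filter_upwards [eventually_gt_atTop 0] with n hn ω _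
    have hn' : (0 : ℝ) < n := by exact_mod_cast hn
    have hh := H.hh n
    have h0 := H.param_pos n 0
    have h1 := H.param_pos n 1
    have hs : √(n * h n : ℝ) ^ 2 = n * h n := Real.sq_sqrt (by positivity)
    have hs0 : 0 < √(n * h n : ℝ) := Real.sqrt_pos.2 (by positivity)
    rw [scaled_info_apply h0.ne', sumIncr_eq_of_normScore hn (H.h_pos n) h0 h1]
    set y := √(θ n 0 / θ n 1) * normScore X h n (θ n) ω 1 with hy
    have e : 1 / √(n * h n : ℝ) * (n * h n * (θ n 0 - 1 / √(n * h n : ℝ) * y) / θ n 1) *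
        (1 / √(n * h n : ℝ)) - θ n 0 / θ n 1 = -(1 / √(n * h n : ℝ) * (y * (θ n 1)⁻¹)) := by
      field_simp
      linear_combination (y - √(n * h n : ℝ) * θ n 0) * hs
    exact e.symm

end IGSequence

end Sequences

/-! ### The likelihood expansion and the limit law of the estimator -/

lemma abs_log_one_add_sub_le {x : ℝ} (h : |x| ≤ 1 / 2) :
    |Real.log (1 + x) - x + x ^ 2 / 2| ≤ 2 * |x| ^ 3 := by
  have h1 := Real.abs_log_sub_add_sum_range_le (x := -x) (by rw [abs_neg]; linarith) 2
  rw [abs_neg] at h1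
  simp only [Finset.sum_range_succ, Finset.sum_range_zero] at h1
  have e : 0 + (-x) ^ (0 + 1) / ((0 : ℕ) + 1 : ℝ) + (-x) ^ (1 + 1) / ((1 : ℕ) + 1 : ℝ) +
      Real.log (1 - -x) = Real.log (1 + x) - x + x ^ 2 / 2 := by
    norm_num
    ring
  rw [e] at h1
  refine h1.trans ((div_le_iff₀ (by linarith)).2 ?_)
  have : 0 ≤ |x| ^ 3 := by positivity
  norm_num
  nlinarith

lemma blDist_congr_ae {Ω : Type*} [MeasurableSpace Ω] {E : Type*} [PseudoEMetricSpace E]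
    [MeasurableSpace E] {P : Measure Ω} {ζ ζ' : Ω → E} (h : ζ =ᵐ[P] ζ') (ν : Measure E) :
    blDist P ζ ν = blDist P ζ' ν := by
  have e : ∀ f : E → ℝ, ∫ ω, f (ζ ω) ∂P = ∫ ω, f (ζ' ω) ∂P := fun f =>
    integral_congr_ae (h.fun_comp f)
  simp only [blDist, e]

/-- Substituting the affine expressions of the statistics, `γδh` in `A` cancels the leading part of
`T² / B`; what remains has size `h κ = τ r`, which explains the factor `r` before the term in `y`.
-/
lemma mleOf_eq {n h δ γ z y τ κ r : ℝ} (hn : 0 < n) (hh : 0 < h) (hδ : 0 < δ) (hγ : 0 < γ)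
    (hd : δ - κ * y ≠ 0) (hτ : τ = κ * r) (hr : r ^ 2 = h) :
    mleOf n (n * h) (n * (1 + γ * δ * h - √2 * τ * z) / δ ^ 2) (n * h * (δ - κ * y) / γ) =
      !₂[δ * (√(1 - τ * (√2 * z + r * (γ * δ * y * (δ - κ * y)⁻¹))))⁻¹,
        γ * (δ - κ * y)⁻¹ * (δ * (√(1 - τ * (√2 * z + r * (γ * δ * y * (δ - κ * y)⁻¹))))⁻¹)] := by
  have e : 1 / n * (n * (1 + γ * δ * h - √2 * τ * z) / δ ^ 2 -
      (n * h) ^ 2 / (n * h * (δ - κ * y) / γ)) =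
      (1 - τ * (√2 * z + r * (γ * δ * y * (δ - κ * y)⁻¹))) / δ ^ 2 := by
    subst hr hτ
    have : r ≠ 0 := by rintro rfl; simp at hh
    field_simp
    ring
  have e2 : (√(1 / n * (n * (1 + γ * δ * h - √2 * τ * z) / δ ^ 2 -
      (n * h) ^ 2 / (n * h * (δ - κ * y) / γ))))⁻¹ =
      δ * (√(1 - τ * (√2 * z + r * (γ * δ * y * (δ - κ * y)⁻¹))))⁻¹ := by
    rw [e, Real.sqrt_div' _ (sq_nonneg δ), Real.sqrt_sq hδ.le, inv_div, div_eq_mul_inv]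
  rw [mleOf, e2]
  congr 3
  field_simp

lemma inv_igRate {h : ℕ → ℝ≥0} {n : ℕ} (hn : 0 < n) (hh : 0 < h n) :
    (Matrix.diagonal (igRate h n))⁻¹ = Matrix.diagonal ![√(n : ℝ), √(n * h n : ℝ)] := by
  have hn' : (0 : ℝ) < n := by exact_mod_cast hn
  have hh' : (0 : ℝ) < h n := by exact_mod_cast hh
  refine inv_diagonal_two fun i => ?_
  fin_cases i
  · simp [igRate, (Real.sqrt_pos.2 hn').ne']
  · have := (Real.sqrt_pos.2 (mul_pos hn' hh')).ne'
    simp only [igRate]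
    change 1 / √(n * h n : ℝ) * √(n * h n : ℝ) = 1
    field_simp

lemma tendsto_vec_two_zero {ι : Type*} {l : Filter ι} {f g : ι → ℝ} (hf : Tendsto f l (𝓝 0))
    (hg : Tendsto g l (𝓝 0)) : Tendsto (fun i => !₂[f i, g i]) l (𝓝 0) := by
  refine ((PiLp.continuous_toLp 2 fun _ : Fin 2 => ℝ).tendsto 0).comp (tendsto_pi_nhds.2
    (Fin.forall_fin_two.2 ⟨?_, ?_⟩))
  · simpa using hf
  · simpa using hg

namespace IGSequence

variable {Ω : Type*} [MeasurableSpace Ω] {X : ℝ≥0 → Ω → ℝ} {h : ℕ → ℝ≥0} {P : ℕ → Measure Ω}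
  {θ : ℕ → EuclideanSpace ℝ (Fin 2)} {c C : ℝ} (H : IGSequence X h P θ c C)
include H

lemma tendsto_expansion {u : ℕ → EuclideanSpace ℝ (Fin 2)}
    (hu : Bornology.IsBounded (Set.range u)) :
    Tendsto (fun n => probDist (P n) (fun ω =>
        let v : EuclideanSpace ℝ (Fin 2) :=
          Matrix.toEuclideanLin (Matrix.diagonal (igRate h n)) (u n)
        let l : EuclideanSpace ℝ (Fin 2) → ℝ := fun ρ => igLogLik X h n ρ ω
        l (θ n + v) - l (θ n) - (∑ i, scoreFun l (θ n) i * v i -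
          1 / 2 * ∑ i, ∑ j, observedInfo l (θ n) i j * v i * v j)) 0) atTop (𝓝 0) := by
  refine H.tendsto_probDist (b := fun _ => 0) fun M => ?_
  obtain ⟨B, hB⟩ := hu.exists_norm_le
  have hu0 : ∀ n, |u n 0| ≤ B := fun n => by
    have := (PiLp.norm_apply_le (u n) 0).trans (hB _ ⟨n, rfl⟩)
    rwa [Real.norm_eq_abs] at this
  have hB0 : 0 ≤ B := (abs_nonneg _).trans (hu0 0)
  have hc := H.pos
  -- With relative step `x = O(n^(-1/2))`, the cubic remainder of `log (1 + x)` times `n` is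
  -- `O(n^(-1/2))`.
  have key : Tendsto (fun n : ℕ => n * (Real.log (θ n 0 + 1 / √(n : ℝ) * u n 0) -
      Real.log (θ n 0) - 1 / √(n : ℝ) * u n 0 / θ n 0 +
      (1 / √(n : ℝ) * u n 0) ^ 2 / (2 * θ n 0 ^ 2))) atTop (𝓝 0) := by
    have t1 : Tendsto (fun n : ℕ => B / c * (1 / √(n : ℝ))) atTop (𝓝 0) := by
      simpa using tendsto_one_div_sqrt_natCast.const_mul (B / c)
    have t2 : Tendsto (fun n : ℕ => 2 * (B / c) ^ 3 * (1 / √(n : ℝ))) atTop (𝓝 0) := by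
      simpa using tendsto_one_div_sqrt_natCast.const_mul (2 * (B / c) ^ 3)
    refine squeeze_zero_norm' ?_ t2
    filter_upwards [t1.eventually (Iic_mem_nhds (by norm_num : (0 : ℝ) < 1 / 2)),
      eventually_gt_atTop 0] with n h1 hn
    have hn' : (0 : ℝ) < n := by exact_mod_cast hn
    have hs : √(n : ℝ) ^ 2 = n := Real.sq_sqrt hn'.le
    have hs0 := Real.sqrt_pos.2 hn'
    have h0 := H.param_pos n 0
    set x := 1 / √(n : ℝ) * u n 0 / θ n 0 with hx
    have hxB : |x| ≤ B / c * (1 / √(n : ℝ)) := by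
      rw [hx, abs_div, abs_mul, abs_of_pos h0, abs_of_pos (one_div_pos.2 hs0)]
      calc _ ≤ 1 / √(n : ℝ) * B / c := by
            gcongr
            · exact hu0 n
            · exact (H.bounds n 0).1
        _ = _ := by ring
    have hx2 := hxB.trans h1
    have hx3 := abs_le.1 hx2
    have e1 : θ n 0 + 1 / √(n : ℝ) * u n 0 = θ n 0 * (1 + x) := by
      rw [hx]
      field_simp
    have e2 : (1 / √(n : ℝ) * u n 0) ^ 2 / (2 * θ n 0 ^ 2) = x ^ 2 / 2 := by
      rw [hx]
      field_simp
    rw [e1, Real.log_mul h0.ne' (by linarith), e2, add_sub_cancel_left, Real.norm_eq_abs, abs_mul,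
      abs_of_pos hn']
    calc _ ≤ n * (2 * |x| ^ 3) := by gcongr; exact abs_log_one_add_sub_le hx2
      _ ≤ n * (2 * (B / c * (1 / √(n : ℝ))) ^ 3) := by gcongr
      _ = _ := by
        nth_rw 1 [← hs]
        field_simp
  refine (key.comp tendsto_fst_boundedFilter).congr fun p => ?_
  dsimp only
  rw [igLogLik_expansion (H.param_pos p.1 0).ne', sub_zero, toEuclideanLin_diagonal_apply]
  simp [igRate]

lemma tendsto_mle :
    Tendsto (fun n => blDist (P n) (fun ω => Matrix.toEuclideanLin
      (Matrix.diagonal (igRate h n))⁻¹ (igMLE X h n ω - θ n))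
      (multivariateGaussian 0 (igFisher (θ n))⁻¹)) atTop (𝓝 0) := by
  have e := fun n => inv_igFisher_eq (H.param_pos n 0) (H.param_pos n 1)
  -- The estimator uses `X_T`, the standardised score the sum of the increments; the
  -- bounded-Lipschitz distance does not see the null set where they differ.
  have e2 : ∀ n, (fun ω => Matrix.toEuclideanLin
      (Matrix.diagonal (igRate h n))⁻¹ (igMLE X h n ω - θ n)) =ᵐ[P n] fun ω =>
      Matrix.toEuclideanLin (Matrix.diagonal (igRate h n))⁻¹
        (mleOf n (n * h n) (sumInvIncr X h n ω) (sumIncr X h n ω) - θ n) := fun n => by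
    filter_upwards [(H.ig n).ae_eq_sumIncr n] with ω hω
    rw [igMLE_eq, hω]
  simp_rw [e, fun n => blDist_congr_ae (e2 n)]
  have hc := H.pos
  have hC := H.C_pos
  refine H.tendsto_blDist (v := fun n => ![θ n 0 / √2, √(θ n 1 / θ n 0)])
    (L := Real.toNNReal (C / √2 + √(C / c))) (fun n i => ?_)
    (fun n => Measurable.mono (measurable_of_statistics (X := X) (h := h) (n := n)
      (g := fun p => Matrix.toEuclideanLin (Matrix.diagonal (igRate h n))⁻¹
        (mleOf n (n * h n) p.1 p.2.1 - θ n)) ((measurable_toEuclideanLin _).comp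
        ((measurable_vec_two (by fun_prop) (by fun_prop)).sub_const (θ n))))
      (obsSigma_le (H.ig n).measurable n) le_rfl) (fun M => ?_)
  · rw [Real.coe_toNNReal _ (by positivity)]
    have h0 := H.param_pos n 0
    have h1 := H.param_pos n 1
    have b0 := H.bounds n 0
    have b1 := H.bounds n 1
    have i1 : θ n 0 / √2 ≤ C / √2 := by gcongr; exact b0.2
    have i2 : √(θ n 1 / θ n 0) ≤ √(C / c) := by
      gcongr
      · exact b1.2
      · exact b0.1
    fin_cases i
    · change |θ n 0 / √2| ≤ _
      rw [abs_of_pos (by positivity)]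
      linarith [Real.sqrt_nonneg (C / c)]
    · change |√(θ n 1 / θ n 0)| ≤ _
      rw [abs_of_pos (by positivity)]
      have : 0 ≤ C / √2 := by positivity
      linarith
  · obtain ⟨M', hM'⟩ := H.normScore_bounds M
    have hfst := tendsto_fst_boundedFilter (Z := fun n => normScore X h n (θ n)) (M := M)
    have hκ := H.tendsto_rate_one.comp hfst
    obtain ⟨t0, t1⟩ := tendsto_mle_expansion
      (l := boundedFilter (fun n => normScore X h n (θ n)) M)
      (δ := fun p => θ p.1 0) (γ := fun p => θ p.1 1) (τ := fun p => 1 / √(p.1 : ℝ))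
      (κ := fun p => 1 / √(p.1 * h p.1 : ℝ)) (r := fun p => √(h p.1 : ℝ))
      (z := fun p => normScore X h p.1 (θ p.1) p.2 0)
      (y := fun p => √(θ p.1 0 / θ p.1 1) * normScore X h p.1 (θ p.1) p.2 1)
      hc (.of_forall fun p => H.bounds p.1 0)
      (.of_forall fun p => ⟨H.param_pos p.1 1, (H.bounds p.1 1).2⟩) (hM'.mono fun _ h => h.1)
      (hM'.mono fun _ h => h.2) (tendsto_one_div_sqrt_natCast.comp hfst) hκ
      (H.tendsto_sqrt_h.comp hfst)
      (hfst.eventually ((eventually_gt_atTop 0).mono fun n hn => H.rate_eq hn))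
      (fun _ => rfl) (fun _ => rfl)
    -- Eventually `κ y < c ≤ δ` on the bounded event, so the denominator `δ - κ y`, proportional to
    -- `B`, is positive there.
    have hκy := (tendsto_zero_mul_isBigO hκ (isBigO_one_of_abs_le
      (hM'.mono fun _ h => h.2))).eventually (Iio_mem_nhds hc)
    refine (tendsto_vec_two_zero t0 t1).congr' ?_
    filter_upwards [hκy, hfst.eventually (eventually_gt_atTop 0)] with p hp hn
    have hn' : (0 : ℝ) < p.1 := by exact_mod_cast hn
    have hh := H.hh p.1
    have h0 := H.param_pos p.1 0
    have h1 := H.param_pos p.1 1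
    have hd : θ p.1 0 - 1 / √(p.1 * h p.1 : ℝ) *
        (√(θ p.1 0 / θ p.1 1) * normScore X h p.1 (θ p.1) p.2 1) ≠ 0 :=
      (sub_pos.2 (lt_of_lt_of_le hp (H.bounds p.1 0).1)).ne'
    rw [sumInvIncr_eq hn h0, sumIncr_eq_of_normScore hn (H.h_pos p.1) h0 h1,
      mleOf_eq hn' hh h0 h1 hd (H.rate_eq hn).2.2 (Real.sq_sqrt hh.le), inv_igRate hn (H.h_pos p.1),
      toEuclideanLin_diagonal_apply, toEuclideanLin_diagonal_apply]
    ext i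
    fin_cases i
    · simp
      ring
    · have hs : √(θ p.1 1 / θ p.1 0) = θ p.1 1 / θ p.1 0 * √(θ p.1 0 / θ p.1 1) := by
        rw [← Real.sqrt_sq (div_pos h1 h0).le, ← Real.sqrt_mul (sq_nonneg _),
          Real.sqrt_sq (div_pos h1 h0).le]
        congr 1
        field_simp
      simp [hs, -Real.sqrt_mul, -Real.sqrt_mul', -Nat.cast_nonneg]
      ring

end IGSequence

/-! ### From sequences back to compact sets, and the main theorem -/

lemma exists_coord_bounds {K : Set (EuclideanSpace ℝ (Fin 2))} (hK : IsCompact K)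
    (hpos : K ⊆ posQuadrant) : ∃ c C : ℝ, 0 < c ∧ ∀ θ ∈ K, ∀ i, c ≤ θ i ∧ θ i ≤ C := by
  rcases K.eq_empty_or_nonempty with rfl | hne
  · exact ⟨1, 1, one_pos, by simp⟩
  have hc : ∀ i : Fin 2, ContinuousOn (fun θ : EuclideanSpace ℝ (Fin 2) => θ i) K := fun i =>
    (EuclideanSpace.proj (𝕜 := ℝ) i).continuous.continuousOn
  obtain ⟨a, ha, ha'⟩ := hK.exists_isMinOn hne (hc 0)
  obtain ⟨b, hb, hb'⟩ := hK.exists_isMinOn hne (hc 1)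
  obtain ⟨a1, -, ha1⟩ := hK.exists_isMaxOn hne (hc 0)
  obtain ⟨b1, -, hb1⟩ := hK.exists_isMaxOn hne (hc 1)
  refine ⟨min (a 0) (b 1), max (a1 0) (b1 1), lt_min (hpos ha).1 (hpos hb).2, fun θ hθ => ?_⟩
  exact Fin.forall_fin_two.2 ⟨⟨(min_le_left _ _).trans (ha' hθ), (ha1 hθ).trans (le_max_left _ _)⟩,
    ⟨(min_le_right _ _).trans (hb' hθ), (hb1 hθ).trans (le_max_right _ _)⟩⟩

lemma unifTendsto_zero_of_igSequence {Ω : Type*} [MeasurableSpace Ω]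
    {Θ : Set (EuclideanSpace ℝ (Fin 2))} (hΘ : Θ ⊆ posQuadrant)
    {P : EuclideanSpace ℝ (Fin 2) → Measure Ω} (hP : ∀ θ ∈ Θ, IsProbabilityMeasure (P θ))
    {X : ℝ≥0 → Ω → ℝ} (hX : ∀ θ ∈ Θ, IsIGSubordinator X (P θ) (θ 0) (θ 1))
    {h : ℕ → ℝ≥0} (h_pos : ∀ n, 0 < h n)
    (hT : Tendsto (fun n => (n * h n : ℝ)) atTop atTop) (h_zero : Tendsto h atTop (𝓝 0))
    {g : ℕ → EuclideanSpace ℝ (Fin 2) → ℝ}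
    (hg : ∀ (θ : ℕ → EuclideanSpace ℝ (Fin 2)) (c C : ℝ),
      IGSequence X h (fun n => P (θ n)) θ c C → Tendsto (fun n => g n (θ n)) atTop (𝓝 0)) :
    UnifTendsto Θ g (fun _ => 0) := by
  intro K hKΘ hK
  obtain ⟨c, C, hc, hb⟩ := exists_coord_bounds hK (hKΘ.trans hΘ)
  refine tendstoUniformlyOn_zero_of_forall_seq fun θ hθ => hg θ c C ?_
  exact ⟨hc, fun n => hb _ (hθ n), fun n => hP _ (hKΘ (hθ n)), fun n => hX _ (hKΘ (hθ n)), h_pos,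
    hT, h_zero⟩

theorem mainTheorem9 {Ω : Type*} [MeasurableSpace Ω]
    (Θ : Set (EuclideanSpace ℝ (Fin 2))) (hΘ_open : IsOpen Θ) (hΘ_conv : Convex ℝ Θ)
    (hΘ_bdd : Bornology.IsBounded Θ) (hΘ_pos : closure Θ ⊆ posQuadrant)
    (P : EuclideanSpace ℝ (Fin 2) → Measure Ω) (hP : ∀ θ ∈ Θ, IsProbabilityMeasure (P θ))
    (X : ℝ≥0 → Ω → ℝ) (hX : ∀ θ ∈ Θ, IsIGSubordinator X (P θ) (θ 0) (θ 1))
    (h : ℕ → ℝ≥0) (h_pos : ∀ n, 0 < h n)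
    (hT : Tendsto (fun n => (n * h n : ℝ)) atTop atTop)
    (h_zero : Tendsto h atTop (𝓝 0)) :
    -- the estimator is almost surely a maximizer of the likelihood
    (∀ n, 2 ≤ n → ∀ θ ∈ Θ, ∀ᵐ ω ∂(P θ), igMLE X h n ω ∈ posQuadrant ∧
      IsMaxOn (fun ρ => igLogLik X h n ρ ω) posQuadrant (igMLE X h n ω)) ∧
    -- uniform local asymptotic normality
    IsULAN (obsSigma X h) P Θ (igLogLik X h) (fun n _ => igRate h n) igFisher ∧
    -- uniform asymptotic normality of the estimator
    UnifTendstoInLaw (obsSigma X h) P Θ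
      (fun n θ ω =>
        Matrix.toEuclideanLin (Matrix.diagonal (igRate h n))⁻¹ (igMLE X h n ω - θ))
      (fun θ => multivariateGaussian 0 (igFisher θ)⁻¹) := by
  have hΘ : Θ ⊆ posQuadrant := subset_closure.trans hΘ_pos
  have hne : ∀ θ ∈ Θ, θ 0 ≠ 0 := fun θ hθ => (hΘ hθ).1.ne'
  refine ⟨fun n hn θ hθ => ?_, ?_, ?_⟩
  · have := hP θ hθ
    exact (hX θ hθ).ae_isMaxOn (h_pos n) hn
  · refine ⟨fun n θ _ => measurable_igLogLik_obsSigma n θ, fun n θ _ => .of_forall fun ω => ?_,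
      fun n hn θ _ => ?_, fun k => ?_, fun θ hθ => posDef_igFisher (hΘ hθ).1 (hΘ hθ).2,
      ⟨fun K hK _ => .of_forall fun n θ hθ => ?_, ?_⟩,
      fun i j => ⟨fun K hK _ => .of_forall fun n θ hθ => ?_, ?_⟩,
      fun u hu => ⟨fun K hK _ => .of_forall fun n θ hθ => ?_, ?_⟩⟩
    · rw [igLogLik_eq]
      exact contDiffOn_quadLogLik _ _ _ _ hne
    · have hn' : (0 : ℝ) < n := by exact_mod_cast hn
      have hh : (0 : ℝ) < h n := by exact_mod_cast h_pos n
      exact Fin.forall_fin_two.2 ⟨one_div_pos.2 (Real.sqrt_pos.2 hn'),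
        one_div_pos.2 (Real.sqrt_pos.2 (mul_pos hn' hh))⟩
    · refine unifTendsto_zero_of_igSequence hΘ hP hX h_pos hT h_zero fun θ c C H => ?_
      fin_cases k
      · exact tendsto_one_div_sqrt_natCast
      · exact H.tendsto_rate_one
    · exact measurable_score (hne θ (hK hθ)) n _
    · exact unifTendsto_zero_of_igSequence hΘ hP hX h_pos hT h_zero fun θ c C H => H.tendsto_score
    · exact measurable_info (hne θ (hK hθ)) n _ i j
    · exact unifTendsto_zero_of_igSequence hΘ hP hX h_pos hT h_zero fun θ c C H =>
        H.tendsto_info i j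
    -- The remainder is a constant function of the outcome, hence measurable for every σ-algebra.
    · dsimp only
      simp_rw [igLogLik_expansion (hne θ (hK hθ))]
      exact measurable_const
    · exact unifTendsto_zero_of_igSequence hΘ hP hX h_pos hT h_zero fun θ c C H =>
        H.tendsto_expansion hu
  · exact ⟨fun K hK _ => .of_forall fun n θ _ => measurable_mle θ n _,
      unifTendsto_zero_of_igSequence hΘ hP hX h_pos hT h_zero fun θ c C H => H.tendsto_mle⟩
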